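/- Conventions. $[n]=\{1,\dots,n\}$, and $S_n$ is the group of permutations of $\{1,2,\dots\}$ fixing every $i>n$. Let $\mathbf x=(x_1,x_2,\dots)$, $\mathbf t=(t_1,t_2,\dots)$, and for $f\in\mathbb Z[\mathbf t][\mathbf x]$ and a permutation $\sigma$ put $\operatorname{ev}_\sigma f=f(t_{\sigma(1)},t_{\sigma(2)},\dots;\mathbf t)$. Forests. An indexed forest is a sequence $F=(T_1,T_2,\dots)$ of plane binary trees (every node has an ordered pair of children or is a leaf), all but finitely many consisting of a single leaf; $\emptyset$ is the forest in which all do. The leaves of $F$ are numbered $1,2,\dots$ from left to right, and $\mathsf{Forest}_n$ is the set of forests whose nontrivial trees have all their leaves in $[n]$. An internal node is terminal if both its children are leaves; $\operatorname{QDes}(F)$ is the set of the left leaves of the terminal nodes, and for $i\in\operatorname{QDes}(F)$ the forest $F/i$ is obtained by replacing the terminal node with left leaf $i$ by a leaf. Double forest polynomials. Let $$\mathsf E_if=\frac{f(x_1,\dots,x_{i-1},x_i,t_i,x_{i+1},\dots;\mathbf t)-f(x_1,\dots,x_{i-1},t_i,x_i,x_{i+1},\dots;\mathbf t)}{x_i-t_i}.$$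 The double forest polynomials $\mathfrak P_F\in\mathbb Z[\mathbf t][\mathbf x]$ are the unique family of homogeneous polynomials, indexed by all indexed forests $F$, such that $\mathfrak P_F(\mathbf t;\mathbf t)$ is $1$ if $F=\emptyset$ and $0$ otherwise, and such that $\mathsf E_i\mathfrak P_F=\mathfrak P_{F/i}(\mathbf x;t_1,\dots,t_{i-1},t_{i+1},\dots)$ if $i\in\operatorname{QDes}(F)$ and $\mathsf E_i\mathfrak P_F=0$ otherwise. Noncrossing permutations. A set partition of $[n]$ is noncrossing if there are no $a<c<b<d$ with $a,b$ in one block and $c,d$ in another block. $\mathrm{NC}_n\subset S_n$ is the set of the products, over the blocks $\{a_1<\dots<a_p\}$ of a noncrossing partition of $[n]$, of the cycles $(a_p\,a_{p-1}\cdots a_1)$, i.e. $a_p\mapsto a_{p-1}\mapsto\dots\mapsto a_1\mapsto a_p$. For $\sigma\in \mathrm{NC}_n$ the noncrossing inversion set is $$\operatorname{Inv}_{\mathrm{NC}}(\sigma)=\{(i,j)\in[n]^2 : i<j,\ \sigma\cdot(i\,j)\in \mathrm{NC}_n,\ \sigma(i)>\sigma(j)\}.$$ The map $\operatorname{ForToNC}:\mathsf{Forest}_n\to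 \mathrm{NC}_n$. For each internal node $v$ of $F$ that is the right child of its parent, delete $v$, attach the right child of $v$ in the place of $v$, and let the left child of $v$ become the root of a separate tree. The leaf sets contained in $[n]$ of the resulting trees are the blocks of a noncrossing partition of $[n]$, and $\operatorname{ForToNC}(F)$ is the corresponding element of $\mathrm{NC}_n$. Theorem. Let $F\in\mathsf{Forest}_n$ and $\sigma=\operatorname{ForToNC}(F)$. Then $\sigma\in \mathrm{NC}_n$ and $$\operatorname{ev}_\sigma(\mathfrak P_F)=\prod_{(a,b)\in\operatorname{Inv}_{\mathrm{NC}}(\sigma)}\bigl(t_{\sigma(a)}-t_{\sigma(b)}\bigr).$$ -/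

import Mathlib

/-!
Conventions. The positive integers `1, 2, 3, …` that index leaves and variables are shifted to
`0, 1, 2, … : ℕ`; so the set `[n]` is `Finset.range n`, and the variables are `x 0, x 1, …` and
`t 0, t 1, …`. The symmetric group `S_n` is seen inside the group of permutations of `ℕ`, as the
permutations that fix every `i ≥ n`.
-/

namespace DoubleForest

noncomputable section

/-! ### Binary trees and indexed forests -/

/-- Plane binary trees: each node has two children or none; `nil` is the trivial tree `*`,
i.e. a leaf. -/
abbrev PlaneTree : Type := BinaryTree Unit

/-- Plane binary trees whose leaves are labelled by natural numbers. -/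
inductive LTree : Type
  | leaf (i : ℕ) : LTree
  | node (l r : LTree) : LTree

namespace LTree

/-- The labels of the leaves, from left to right. -/
def leaves : LTree → List ℕ
  | leaf i => [i]
  | node l r => l.leaves ++ r.leaves

/-- The internal nodes of a tree; a node is given by the subtree below it. -/
def internal : LTree → List LTree
  | leaf _ => []
  | node l r => node l r :: (l.internal ++ r.internal)

/-- An internal node is terminal if both of its children are leaves. -/
def IsTerminal (v : LTree) : Prop := ∃ i j, v = node (leaf i) (leaf j)

/-- The leaf reached from the root by going down left edges. -/
def flag : LTree → ℕ
  | leaf i => i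
  | node l _ => l.flag

/-- Deletion of the left edges of all right children. The flag `isRight` says whether the root
of the given tree is a right child. The result consists of what remains at the place of this root,
and of the trees that are split off.

If an internal node is a right child, it is deleted, its right child takes its place, and its left
child becomes the root of a new tree. Otherwise the node stays. -/
def cut : (isRight : Bool) → LTree → LTree × List LTree
  | _, leaf i => (leaf i, [])
  | false, node l r =>
      (node (cut false l).1 (cut true r).1, (cut false l).2 ++ (cut true r).2)
  | true, node l r =>
      ((cut true r).1, (cut false l).1 :: ((cut false l).2 ++ (cut true r).2))

end LTree

/-- Label the leaves of a plane tree from left to right by `a, a + 1, a + 2, …`. -/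
def label : PlaneTree → ℕ → LTree
  | .nil, a => .leaf a
  | .node _ l r, a => .node (label l a) (label r (a + l.numLeaves))

/-- In a plane tree whose leaves are labelled by `a, a + 1, …`, delete the terminal node whose left
leaf is `i` (the node becomes a leaf). Nothing happens if there is no such node. -/
def trimTree : PlaneTree → ℕ → ℕ → PlaneTree
  | .nil, _, _ => .nil
  | .node _ l r, a, i =>
      if l = .nil ∧ r = .nil ∧ i = a then .nil
      else .node () (trimTree l a i) (trimTree r (a + l.numLeaves) i)

theorem trimTree_nil (a i : ℕ) : trimTree .nil a i = .nil := rfl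

/-- An indexed forest: a sequence of plane binary trees, all but finitely many trivial. -/
@[ext]
structure IndexedForest : Type where
  tree : ℕ → PlaneTree
  finite : {k | tree k ≠ .nil}.Finite

namespace IndexedForest

/-- The empty forest: all trees are trivial. -/
def empty : IndexedForest where
  tree _ := .nil
  finite := by simp

/-- The first leaf of the `k`-th tree, when all leaves of the forest are numbered from left to
right. -/
def start (F : IndexedForest) (k : ℕ) : ℕ := ∑ j ∈ Finset.range k, (F.tree j).numLeaves

/-- The `k`-th tree of the forest, with its leaves labelled by their numbers in the forest. -/
def labelled (F : IndexedForest) (k : ℕ) : LTree := label (F.tree k) (F.start k)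

/-- The support: the set of leaves of the nontrivial trees. -/
def supp (F : IndexedForest) : Set ℕ :=
  {m | ∃ k, F.tree k ≠ .nil ∧ m ∈ (F.labelled k).leaves}

/-- The set `QDes(F)` of the left leaves of the terminal nodes. -/
def qdes (F : IndexedForest) : Set ℕ :=
  {i | ∃ k, ∃ v ∈ (F.labelled k).internal, v.IsTerminal ∧ v.flag = i}

/-- The trimmed forest `F/i`, for `i ∈ QDes(F)`: delete the terminal node `v` with left leaf
`i`. -/
def trim (F : IndexedForest) (i : ℕ) : IndexedForest where
  tree k := trimTree (F.tree k) (F.start k) i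
  finite := F.finite.subset fun k hk h => hk (by
    show trimTree (F.tree k) (F.start k) i = .nil
    rw [h]
    exact trimTree_nil _ _)

/-- The family of leaf-labelled trees of the nested forest `LC(F)`, obtained from `F` by deleting
the left edge of each right child. -/
def LC (F : IndexedForest) : Set LTree :=
  {T | ∃ k, T = ((F.labelled k).cut false).1 ∨ T ∈ ((F.labelled k).cut false).2}

end IndexedForest

/-- The forests supported on `[n]`. -/
def Forest (n : ℕ) : Set IndexedForest := {F | F.supp ⊆ ↑(Finset.range n)}

/-! ### Noncrossing permutations -/

/-- A partition of `[n]` is noncrossing if there are no `a < c < b < d` with `a, b` in one block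
and `c, d` in another. -/
def IsNoncrossing {n : ℕ} (P : Finpartition (Finset.range n)) : Prop :=
  ∀ B ∈ P.parts, ∀ C ∈ P.parts, B ≠ C →
    ∀ a ∈ B, ∀ b ∈ B, ∀ c ∈ C, ∀ d ∈ C, ¬ (a < c ∧ c < b ∧ b < d)

/-- The backward cycle `(a_p a_{p-1} … a_1)` of a set `{a_p > a_{p-1} > … > a_1}`, which maps
`a_p ↦ a_{p-1} ↦ … ↦ a_1 ↦ a_p`. -/
def backCycle (B : Finset ℕ) : Equiv.Perm ℕ := (B.sort (· ≥ ·)).formPerm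

/-- The product of the backward cycles of a finite family of blocks. The blocks will be pairwise
disjoint, so that these cycles commute and the order of the product does not matter. -/
def permOfBlocks (P : Finset (Finset ℕ)) : Equiv.Perm ℕ := (P.toList.map backCycle).prod

/-- The set `NC_n` of noncrossing permutations of `[n]`. -/
def NC (n : ℕ) : Set (Equiv.Perm ℕ) :=
  {σ | ∃ P : Finpartition (Finset.range n), IsNoncrossing P ∧ σ = permOfBlocks P.parts}

open Classical in
/-- The permutation of `[n]` whose cycles are the leaf sets, as far as they are contained in `[n]`,
of the trees of a nested forest. -/
def NCPerm (n : ℕ) (S : Set LTree) : Equiv.Perm ℕ :=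
  permOfBlocks {B ∈ (Finset.range n).powerset | ∃ T ∈ S, T.leaves.toFinset = B}

/-- The map `ForToNC` from `Forest n` to `NC n`. -/
def ForToNC (n : ℕ) (F : IndexedForest) : Equiv.Perm ℕ := NCPerm n F.LC

open Classical in
/-- The noncrossing inversion set of a noncrossing permutation of `[n]`. -/
def invNC (n : ℕ) (σ : Equiv.Perm ℕ) : Finset (ℕ × ℕ) :=
  {p ∈ Finset.range n ×ˢ Finset.range n |
    p.1 < p.2 ∧ σ * Equiv.swap p.1 p.2 ∈ NC n ∧ σ p.1 > σ p.2}

/-! ### Double forest polynomials -/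

/-- The ring `ℤ[t][x]`, as the polynomial ring in both sets of variables. -/
abbrev PolyTX : Type := MvPolynomial (ℕ ⊕ ℕ) ℤ

/-- The ring `ℤ[t]`. -/
abbrev PolyT : Type := MvPolynomial ℕ ℤ

/-- The non-equivariant variable `x_i`. -/
def x (i : ℕ) : PolyTX := MvPolynomial.X (Sum.inl i)

/-- The equivariant variable `t_i`. -/
def t (i : ℕ) : PolyTX := MvPolynomial.X (Sum.inr i)

/-- The evaluation `ev_σ f = f(t_{σ(1)}, t_{σ(2)}, …; t)`. -/
def ev (σ : Equiv.Perm ℕ) : PolyTX →ₐ[ℤ] PolyT :=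
  MvPolynomial.aeval (Sum.elim (fun i => MvPolynomial.X (σ i)) MvPolynomial.X)

/-- The Bergeron–Sottile map `f ↦ f(x_1, …, x_{i-1}, t_i, x_i, x_{i+1}, …; t)`. -/
def ropeMinus (i : ℕ) : PolyTX →ₐ[ℤ] PolyTX :=
  MvPolynomial.aeval
    (Sum.elim (fun j => if j < i then x j else if j = i then t i else x (j - 1)) t)

/-- The Bergeron–Sottile map `f ↦ f(x_1, …, x_{i-1}, x_i, t_i, x_{i+1}, …; t)`. -/
def ropePlus (i : ℕ) : PolyTX →ₐ[ℤ] PolyTX :=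
  MvPolynomial.aeval
    (Sum.elim (fun j => if j < i + 1 then x j else if j = i + 1 then t i else x (j - 1)) t)

theorem dvd_rope_sub (i : ℕ) (f : PolyTX) : x i - t i ∣ ropePlus i f - ropeMinus i f := by
  rw [← Ideal.mem_span_singleton, ← Ideal.Quotient.mk_eq_mk_iff_sub_mem]
  have hxt : Ideal.Quotient.mk (Ideal.span {x i - t i}) (x i) =
      Ideal.Quotient.mk (Ideal.span {x i - t i}) (t i) := by
    rw [Ideal.Quotient.mk_eq_mk_iff_sub_mem]
    exact Ideal.mem_span_singleton_self _
  have h : ((Ideal.Quotient.mkₐ ℤ (Ideal.span {x i - t i})).comp (ropePlus i)) =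
      ((Ideal.Quotient.mkₐ ℤ (Ideal.span {x i - t i})).comp (ropeMinus i)) := by
    apply MvPolynomial.algHom_ext
    rintro (j | j)
    · rcases lt_trichotomy j i with hj | rfl | hj
      · simp [ropePlus, ropeMinus, hj, hj.le]
      · simpa [ropePlus, ropeMinus] using hxt
      · have h1 : ¬ j ≤ i := by omega
        have h2 : ¬ j < i := by omega
        have h3 : j ≠ i := by omega
        by_cases h4 : j = i + 1
        · subst h4
          simpa [ropePlus, ropeMinus] using hxt.symm
        · simp [ropePlus, ropeMinus, h1, h2, h3, h4]
    · simp [ropePlus, ropeMinus]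
  exact DFunLike.congr_fun h f

/-- The equivariant trimming operation `E_i f`, the quotient of `R_i^+ f - R_i^- f` by
`x_i - t_i`. -/
def eope (i : ℕ) (f : PolyTX) : PolyTX := (dvd_rope_sub i f).choose

theorem eope_spec (i : ℕ) (f : PolyTX) :
    ropePlus i f - ropeMinus i f = (x i - t i) * eope i f :=
  (dvd_rope_sub i f).choose_spec

/-- The substitution `f(x; t) ↦ f(x; t_1, …, t_{i-1}, t_{i+1}, …)`. -/
def omitT (i : ℕ) : PolyTX →ₐ[ℤ] PolyTX :=
  MvPolynomial.aeval (Sum.elim x (fun j => if j < i then t j else t (j + 1)))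

/-- The characterization of the family of double forest polynomials: each member is homogeneous
(jointly in `x` and `t`), with the normalization `𝔓_F(t; t) = δ_{F,∅}`, and `E_i 𝔓_F` is
`𝔓_{F/i}(x; t_1, …, t_{i-1}, t_{i+1}, …)` if `i ∈ QDes(F)` and zero otherwise. -/
structure IsDoubleForestFamily (P : IndexedForest → PolyTX) : Prop where
  homogeneous : ∀ F, ∃ d, (P F).IsHomogeneous d
  ev_one_empty : ev 1 (P IndexedForest.empty) = 1
  ev_one : ∀ F, F ≠ IndexedForest.empty → ev 1 (P F) = 0
  eope_mem : ∀ F i, i ∈ F.qdes → eope i (P F) = omitT i (P (F.trim i))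
  eope_notMem : ∀ F i, i ∉ F.qdes → eope i (P F) = 0

open Classical in
/-- The double forest polynomials: the unique family with the above properties. (If there were no
such family, or more than one, the value would be `0`, and so would be all its evaluations.) -/
def doubleForest : IndexedForest → PolyTX :=
  if h : ∃! P : IndexedForest → PolyTX, IsDoubleForestFamily P then h.choose else 0

end

end DoubleForest

/-!
A noncrossing permutation `σ ≠ 1` has a descent between adjacent positions `i` and `i + 1` one of
whose two entries is `i`; deleting this entry gives a noncrossing permutation `w`, and then both `σ`
and `σ s_i` arise from `w` by inserting the value `i`, at the positions `i` and `i + 1`. Hence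
`ev σ f - ev (σ s_i) f` is `t_{σ(i)} - t_{σ(i+1)}` times an evaluation of `E_i f` at `w`. For the
permutation `F.perm` of a forest, each `i ∈ F.qdes` is such a descent, with `w = (F.trim i).perm`.

Descending in the Bruhat order along these relations, one finds that `ev σ 𝔓_F ≠ 0` with `σ`
noncrossing forces `F.perm ≤ σ`. So `ev (F.perm * s_i) 𝔓_F = 0` for `i ∈ F.qdes`, and up to shifting
the variables `ev F.perm 𝔓_F` is `ev (F.trim i).perm 𝔓_{F/i}` times `t_{σ(i)} - t_{σ(i+1)}`, where
`σ = F.perm`. The noncrossing inversions of `F.perm` are likewise those of `(F.trim i).perm`,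
shifted, together with `(i, i + 1)`.
-/

namespace DoubleForest

section Polynomials

open MvPolynomial

/-! ### The trimming operators -/

/-- The Bergeron–Sottile map `f ↦ f(x_0, …, x_{i-1}, t_s, x_i, …; t)`. The index `s` is free, since
omitting an equivariant variable shifts it; `R_i^-` and `R_i^+` are `insertT i i` and
`insertT (i + 1) i`. -/
noncomputable def insertT (i s : ℕ) : PolyTX →ₐ[ℤ] PolyTX :=
  aeval (Sum.elim (fun j => if j < i then x j else if j = i then t s else x (j - 1)) t)

@[simp] theorem insertT_t (i s j : ℕ) : insertT i s (t j) = t j := by simp [insertT, t]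

theorem insertT_x (i s j : ℕ) :
    insertT i s (x j) = if j < i then x j else if j = i then t s else x (j - 1) := by
  simp [insertT, x]

theorem polyTX_hom_ext {A : Type*} [CommSemiring A] [Algebra ℤ A] {φ ψ : PolyTX →ₐ[ℤ] A}
    (hx : ∀ j, φ (x j) = ψ (x j)) (ht : ∀ j, φ (t j) = ψ (t j)) : φ = ψ := by
  apply algHom_ext
  rintro (j | j)
  · exact hx j
  · exact ht j

theorem x_sub_t_ne_zero (i j : ℕ) : x i - t j ≠ 0 := by
  rw [sub_ne_zero]
  exact fun h => by simpa using X_injective h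

/-- The numerator of the trimming operator at position `i` with `t s` in place of `t i`. -/
noncomputable def trimDiff (i s : ℕ) (f : PolyTX) : PolyTX := insertT (i + 1) s f - insertT i s f

theorem trimDiff_self (i : ℕ) (f : PolyTX) : trimDiff i i f = (x i - t i) * eope i f :=
  eope_spec i f

theorem trimDiff_sub (i s : ℕ) (f g : PolyTX) :
    trimDiff i s (f - g) = trimDiff i s f - trimDiff i s g := by
  simp only [trimDiff, map_sub]; ring

theorem trimDiff_add (i s : ℕ) (f g : PolyTX) :
    trimDiff i s (f + g) = trimDiff i s f + trimDiff i s g := by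
  simp only [trimDiff, map_add]; ring

theorem eope_eq_of_trimDiff {i : ℕ} {f g : PolyTX} (h : trimDiff i i f = (x i - t i) * g) :
    eope i f = g :=
  mul_left_cancel₀ (x_sub_t_ne_zero i i) ((trimDiff_self i f).symm.trans h)

theorem eope_sub (i : ℕ) (f g : PolyTX) : eope i (f - g) = eope i f - eope i g :=
  eope_eq_of_trimDiff (by rw [trimDiff_sub, trimDiff_self, trimDiff_self]; ring)

theorem eope_add (i : ℕ) (f g : PolyTX) : eope i (f + g) = eope i f + eope i g :=
  eope_eq_of_trimDiff (by rw [trimDiff_add, trimDiff_self, trimDiff_self]; ring)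

theorem eope_zero (i : ℕ) : eope i 0 = 0 :=
  eope_eq_of_trimDiff (by simp [trimDiff])

theorem insertT_comm {i k : ℕ} (h : k ≤ i) (r s : ℕ) (f : PolyTX) :
    insertT i s (insertT k r f) = insertT k r (insertT (i + 1) s f) := by
  suffices h_comp : (insertT i s).comp (insertT k r) = (insertT k r).comp (insertT (i + 1) s) by
    rw [← AlgHom.comp_apply, h_comp, AlgHom.comp_apply]
  refine polyTX_hom_ext (fun j => ?_) (fun j => by simp)
  simp only [AlgHom.comp_apply, insertT_x]
  grind [insertT_x, insertT_t]

theorem trimDiff_comm {i k : ℕ} (h : k < i) (r s : ℕ) (f : PolyTX) :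
    trimDiff i s (trimDiff k r f) = trimDiff k r (trimDiff (i + 1) s f) := by
  simp only [trimDiff, map_sub]
  rw [insertT_comm (i := i + 1) (k := k + 1) (by omega),
    insertT_comm (i := i + 1) (k := k) (by omega),
    insertT_comm (i := i) (k := k + 1) (by omega), insertT_comm (i := i) (k := k) (by omega)]
  ring

theorem trimDiff_eope {i k : ℕ} (h : k < i) (f : PolyTX) :
    trimDiff i (i + 1) (eope k f) = (x i - t (i + 1)) * eope k (eope (i + 1) f) := by
  apply mul_left_cancel₀ (x_sub_t_ne_zero k k)
  have factor_left : trimDiff i (i + 1) ((x k - t k) * eope k f)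
      = (x k - t k) * trimDiff i (i + 1) (eope k f) := by
    have hk : k < i + 1 := by omega
    simp only [trimDiff, map_sub, map_mul, insertT_x, insertT_t, if_pos h, if_pos hk]
    ring
  have factor_right : trimDiff k k ((x (i + 1) - t (i + 1)) * eope (i + 1) f)
      = (x i - t (i + 1)) * trimDiff k k (eope (i + 1) f) := by
    simp only [trimDiff, map_sub, map_mul, insertT_x, insertT_t, show ¬ i + 1 < k by omega,
      show ¬ i + 1 = k by omega, show ¬ i + 1 < k + 1 by omega, show ¬ i + 1 = k + 1 by omega,
      if_false, Nat.add_sub_cancel]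
    ring
  rw [← factor_left, ← trimDiff_self, trimDiff_comm h, trimDiff_self (i + 1), factor_right,
    trimDiff_self]
  ring

/-! ### Polynomials in finitely many of the `x`-variables -/

/-- The subalgebra `ℤ[t][x_0, …, x_{k-1}]`; it is the common kernel of the operators `E_i` with
`i ≥ k`. -/
noncomputable def xBelow (k : ℕ) : Subalgebra ℤ PolyTX :=
  supported ℤ {v | ∀ j, v = Sum.inl j → j < k}

theorem x_mem_xBelow {j k : ℕ} (h : j < k) : x j ∈ xBelow k := by
  simp [xBelow, x, X_mem_supported, h]

theorem t_mem_xBelow (j k : ℕ) : t j ∈ xBelow k := by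
  simp [xBelow, t, X_mem_supported]

theorem xBelow_mono {k m : ℕ} (h : k ≤ m) : xBelow k ≤ xBelow m :=
  supported_mono fun _ hv j hj => (hv j hj).trans_le h

theorem exists_mem_xBelow (f : PolyTX) : ∃ k, f ∈ xBelow k := by
  induction f using MvPolynomial.induction_on with
  | C a => exact ⟨0, (xBelow 0).algebraMap_mem a⟩
  | add p q hp hq =>
    obtain ⟨k, hk⟩ := hp
    obtain ⟨m, hm⟩ := hq
    exact ⟨max k m, add_mem (xBelow_mono (le_max_left _ _) hk) (xBelow_mono (le_max_right _ _) hm)⟩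
  | mul_X p v hp =>
    obtain ⟨k, hk⟩ := hp
    rcases v with j | j
    · exact ⟨max k (j + 1), mul_mem (xBelow_mono (le_max_left _ _) hk)
        (x_mem_xBelow (lt_max_of_lt_right (Nat.lt_succ_self j)))⟩
    · exact ⟨k, mul_mem hk (t_mem_xBelow j k)⟩

theorem xBelow_le {k : ℕ} {S : Subalgebra ℤ PolyTX} (hx : ∀ j < k, x j ∈ S) (ht : ∀ j, t j ∈ S) :
    xBelow k ≤ S := by
  refine Algebra.adjoin_le ?_
  rintro _ ⟨j | j, hv, rfl⟩
  · exact hx j (hv j rfl)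
  · exact ht j

theorem xBelow_hom_congr {A : Type*} [CommSemiring A] [Algebra ℤ A] {φ ψ : PolyTX →ₐ[ℤ] A} {k : ℕ}
    (hx : ∀ j < k, φ (x j) = ψ (x j)) (ht : ∀ j, φ (t j) = ψ (t j)) {f : PolyTX}
    (hf : f ∈ xBelow k) : φ f = ψ f :=
  xBelow_le (S := AlgHom.equalizer φ ψ) hx ht hf

theorem insertT_of_mem_xBelow {i s : ℕ} {f : PolyTX} (hf : f ∈ xBelow i) : insertT i s f = f :=
  xBelow_hom_congr (φ := insertT i s) (ψ := AlgHom.id ℤ PolyTX)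
    (fun j hj => by simp [insertT_x, hj]) (fun j => by simp) hf

theorem insertT_mem_xBelow {k s : ℕ} {f : PolyTX} (hf : f ∈ xBelow (k + 1)) :
    insertT k s f ∈ xBelow k := by
  refine xBelow_le (S := (xBelow k).comap (insertT k s)) (fun j hj => ?_) (fun j => ?_) hf
  · rw [Subalgebra.mem_comap, insertT_x]
    split_ifs with hlt heq
    · exact x_mem_xBelow hlt
    · exact t_mem_xBelow _ _
    · omega
  · rw [Subalgebra.mem_comap, insertT_t]
    exact t_mem_xBelow _ _

theorem mem_xBelow_of_trimDiff_eq_zero {k : ℕ} (s : ℕ → ℕ) {f : PolyTX}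
    (h : ∀ i, k ≤ i → trimDiff i (s i) f = 0) : f ∈ xBelow k := by
  obtain ⟨m, hm⟩ := exists_mem_xBelow f
  induction m with
  | zero => exact xBelow_mono (Nat.zero_le k) hm
  | succ m ih =>
    rcases Nat.lt_or_ge m k with hk | hk
    · exact xBelow_mono hk hm
    · apply ih
      have hfix := h m hk
      rw [trimDiff, insertT_of_mem_xBelow hm, sub_eq_zero] at hfix
      rw [hfix]
      exact insertT_mem_xBelow hm

theorem eope_of_mem_xBelow {i : ℕ} {f : PolyTX} (hf : f ∈ xBelow i) : eope i f = 0 :=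
  eope_eq_of_trimDiff (by
    rw [trimDiff, insertT_of_mem_xBelow hf, insertT_of_mem_xBelow (xBelow_mono i.le_succ hf)]
    ring)

theorem eope_mul_of_mem_xBelow {i : ℕ} {f : PolyTX} (hf : f ∈ xBelow (i + 1)) :
    eope i ((x i - t i) * f) = f :=
  eope_eq_of_trimDiff (by
    have hmem : (x i - t i) * f ∈ xBelow (i + 1) :=
      mul_mem (sub_mem (x_mem_xBelow i.lt_succ_self) (t_mem_xBelow _ _)) hf
    rw [trimDiff, insertT_of_mem_xBelow hmem]
    simp [insertT_x])

theorem ev_x (σ : Equiv.Perm ℕ) (j : ℕ) : ev σ (x j) = X (σ j) := by simp [ev, x]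

theorem ev_t (σ : Equiv.Perm ℕ) (j : ℕ) : ev σ (t j) = X j := by simp [ev, t]

theorem eq_zero_of_eope_eq_zero {f : PolyTX} (h : ∀ i, eope i f = 0) (h_one : ev 1 f = 0) :
    f = 0 := by
  have hf : f ∈ xBelow 0 := mem_xBelow_of_trimDiff_eq_zero id fun i _ => by
    rw [id, trimDiff_self, h, mul_zero]
  have h_ev := xBelow_hom_congr (φ := (rename Sum.inr).comp (ev 1)) (ψ := AlgHom.id ℤ PolyTX)
    (fun j hj => absurd hj j.not_lt_zero) (fun j => by simp [ev_t]; rfl) hf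
  simpa [h_one] using h_ev.symm

/-! ### Homogeneity -/

theorem isHomogeneous_x_sub_t (i j : ℕ) : (x i - t j).IsHomogeneous 1 :=
  (isHomogeneous_X _ _).sub (isHomogeneous_X _ _)

theorem isHomogeneous_insertT {f : PolyTX} {d : ℕ} (hf : f.IsHomogeneous d) (i s : ℕ) :
    (insertT i s f).IsHomogeneous d := by
  have := hf.aeval (Sum.elim (fun j => if j < i then x j else if j = i then t s else x (j - 1)) t)
    (n := 1) (by
      rintro (j | j)
      · simp only [Sum.elim_inl]
        split_ifs <;> exact isHomogeneous_X _ _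
      · exact isHomogeneous_X _ _)
  simpa [insertT] using this

theorem isHomogeneous_omitT {f : PolyTX} {d : ℕ} (hf : f.IsHomogeneous d) (i : ℕ) :
    (omitT i f).IsHomogeneous d := by
  have := hf.aeval (Sum.elim x (fun j => if j < i then t j else t (j + 1)))
    (n := 1) (by
      rintro (j | j)
      · exact isHomogeneous_X _ _
      · simp only [Sum.elim_inr]
        split_ifs <;> exact isHomogeneous_X _ _)
  simpa [omitT] using this

theorem isHomogeneous_of_mul_left {σ R : Type*} [CommSemiring R] [NoZeroDivisors R]
    {p f : MvPolynomial σ R} {m d : ℕ} (hp : p.IsHomogeneous m) (hp0 : p ≠ 0)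
    (h : (p * f).IsHomogeneous (m + d)) : f.IsHomogeneous d := by
  let _ : GradedAlgebra (homogeneousSubmodule σ R) := gradedAlgebra
  have component_eq_zero : ∀ k ≠ d, homogeneousComponent k f = 0 := by
    intro k hk
    have h_mul : (DirectSum.decompose (homogeneousSubmodule σ R) (p * f) (m + k) :
        MvPolynomial σ R) = p * homogeneousComponent k f := by
      rw [← decomposition.decompose'_apply]
      exact DirectSum.coe_decompose_mul_add_of_left_mem (homogeneousSubmodule σ R) hp
    rw [DirectSum.decompose_of_mem_ne _ h (by omega)] at h_mul
    exact (mul_eq_zero.mp h_mul.symm).resolve_left hp0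
  rw [← sum_homogeneousComponent f]
  refine IsHomogeneous.sum _ _ _ fun k _ => ?_
  by_cases hk : k = d
  · exact hk ▸ homogeneousComponent_isHomogeneous k f
  · exact component_eq_zero k hk ▸ isHomogeneous_zero _ _ _

theorem isHomogeneous_eope {f : PolyTX} {d : ℕ} (hf : f.IsHomogeneous (d + 1)) (i : ℕ) :
    (eope i f).IsHomogeneous d := by
  refine isHomogeneous_of_mul_left (isHomogeneous_x_sub_t i i) (x_sub_t_ne_zero i i) ?_
  rw [← trimDiff_self, add_comm]
  exact (isHomogeneous_insertT hf _ _).sub (isHomogeneous_insertT hf _ _)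

/-! ### Solving `E_i f = g_i` -/

/-- A common solution of `E_i f = g i` for `i ≥ N - k`, provided that the `g i` are compatible and
vanish for `i ≥ N`. It is found by downward recursion on `i`: adding a multiple of `x_i - t_i` by an
element of `xBelow (i + 1)` corrects the image under `E_i` and keeps those under the later
operators. -/
noncomputable def solve (g : ℕ → PolyTX) (N : ℕ) : ℕ → PolyTX
  | 0 => 0
  | k + 1 => solve g N k + (x (N - (k + 1)) - t (N - (k + 1))) *
      (g (N - (k + 1)) - eope (N - (k + 1)) (solve g N k))

theorem ev_one_solve (g : ℕ → PolyTX) (N k : ℕ) : ev 1 (solve g N k) = 0 := by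
  induction k with
  | zero => simp [solve]
  | succ k ih => simp [solve, ih, ev_x, ev_t]

theorem isHomogeneous_solve {g : ℕ → PolyTX} {d : ℕ} (hg : ∀ i, (g i).IsHomogeneous d) (N k : ℕ) :
    (solve g N k).IsHomogeneous (d + 1) := by
  induction k with
  | zero => exact isHomogeneous_zero _ _ _
  | succ k ih =>
    refine ih.add ?_
    rw [add_comm d 1]
    exact (isHomogeneous_x_sub_t _ _).mul ((hg _).sub (isHomogeneous_eope ih _))

theorem eope_solve {g : ℕ → PolyTX} {N : ℕ} (hN : ∀ i, N ≤ i → g i = 0)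
    (hg : ∀ k i, k < i → trimDiff i (i + 1) (g k) = (x i - t (i + 1)) * eope k (g (i + 1)))
    {k : ℕ} (hk : k ≤ N) : ∀ i, N - k ≤ i → eope i (solve g N k) = g i := by
  induction k with
  | zero =>
    intro i hi
    rw [hN i (by omega), solve, eope_zero]
  | succ k ih =>
    rw [solve]
    set m := N - (k + 1)
    have ih : ∀ i, m + 1 ≤ i → eope i (solve g N k) = g i :=
      fun i hi => ih (by omega) i (by omega)
    intro i hi
    have correction_mem : g m - eope m (solve g N k) ∈ xBelow (m + 1) :=
      mem_xBelow_of_trimDiff_eq_zero (fun i => i + 1) fun i hi => by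
        rw [trimDiff_sub, hg m i hi, trimDiff_eope hi, ih (i + 1) (by omega), sub_self]
    rw [eope_add]
    rcases hi.eq_or_lt with rfl | hi
    · rw [eope_mul_of_mem_xBelow correction_mem]; ring
    · rw [ih i hi, eope_of_mem_xBelow, add_zero]
      exact xBelow_mono hi
        (mul_mem (sub_mem (x_mem_xBelow m.lt_succ_self) (t_mem_xBelow _ _)) correction_mem)

/-! ### Omitting an equivariant variable -/

/-- The increasing map from `ℕ` onto the complement of `i`. -/
def skip (i j : ℕ) : ℕ := if j < i then j else j + 1

theorem omitT_x (i j : ℕ) : omitT i (x j) = x j := by simp [omitT, x]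

theorem omitT_t (i j : ℕ) : omitT i (t j) = t (skip i j) := by
  simp only [omitT, t, skip, aeval_X, Sum.elim_inr]; split_ifs <;> rfl

theorem insertT_omitT (i s k : ℕ) (f : PolyTX) :
    insertT i (skip k s) (omitT k f) = omitT k (insertT i s f) := by
  suffices h_comp : (insertT i (skip k s)).comp (omitT k) = (omitT k).comp (insertT i s) by
    rw [← AlgHom.comp_apply, h_comp, AlgHom.comp_apply]
  refine polyTX_hom_ext (fun j => ?_) (fun j => by simp [omitT_t])
  simp only [AlgHom.comp_apply, insertT_x, omitT_x]
  split_ifs <;> simp only [omitT_x, omitT_t]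

theorem trimDiff_omitT (i s k : ℕ) (f : PolyTX) :
    trimDiff i (skip k s) (omitT k f) = omitT k (trimDiff i s f) := by
  simp only [trimDiff, insertT_omitT, map_sub]

theorem eope_omitT {i k : ℕ} (h : i < k) (f : PolyTX) :
    eope i (omitT k f) = omitT k (eope i f) := by
  apply eope_eq_of_trimDiff
  have hskip : skip k i = i := if_pos h
  have h_omit := trimDiff_omitT i i k f
  rwa [hskip, trimDiff_self i f, map_mul, map_sub, omitT_x, omitT_t, hskip] at h_omit

theorem trimDiff_succ_omitT {i k : ℕ} (h : k ≤ i) (f : PolyTX) :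
    trimDiff i (i + 1) (omitT k f) = (x i - t (i + 1)) * omitT k (eope i f) := by
  have hskip : skip k i = i + 1 := if_neg (by omega)
  have h_omit := trimDiff_omitT i i k f
  rwa [hskip, trimDiff_self, map_mul, map_sub, omitT_x, omitT_t, hskip] at h_omit

theorem omitT_comm {i k : ℕ} (h : k ≤ i) (f : PolyTX) :
    omitT k (omitT i f) = omitT (i + 1) (omitT k f) := by
  suffices h_comp : (omitT k).comp (omitT i) = (omitT (i + 1)).comp (omitT k) by
    rw [← AlgHom.comp_apply, h_comp, AlgHom.comp_apply]
  refine polyTX_hom_ext (fun j => by simp [omitT_x]) (fun j => ?_)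
  simp only [AlgHom.comp_apply, omitT_t, skip]
  congr 1
  split_ifs <;> omega

end Polynomials

section Permutations

open Equiv

/-! ### Inserting an entry into a permutation -/

theorem skip_of_lt {i j : ℕ} (h : j < i) : skip i j = j := if_pos h

theorem skip_of_le {i j : ℕ} (h : i ≤ j) : skip i j = j + 1 := if_neg h.not_gt

theorem skip_ne (i j : ℕ) : skip i j ≠ i := by unfold skip; split_ifs <;> omega

theorem skip_strictMono (i : ℕ) : StrictMono (skip i) := fun a b h => by
  unfold skip; split_ifs <;> omega

theorem skip_lt_skip_iff {i a b : ℕ} : skip i a < skip i b ↔ a < b := (skip_strictMono i).lt_iff_lt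

/-- The bijection from `ℕ` with an extra point onto `ℕ` that sends this point to `i`. -/
def optionSkip (i : ℕ) : Option ℕ ≃ ℕ where
  toFun o := o.elim i (skip i)
  invFun j := if j = i then none else some (if j < i then j else j - 1)
  left_inv o := by
    rcases o with _ | j
    · simp
    · simp only [Option.elim_some, skip_ne, if_false, Option.some_inj]
      unfold skip; split_ifs <;> omega
  right_inv j := by
    by_cases h : j = i
    · simp [h]
    · simp only [h, if_false, Option.elim_some]
      unfold skip; split_ifs <;> omega

theorem eq_or_exists_eq_skip (i j : ℕ) : j = i ∨ ∃ k, j = skip i k := by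
  obtain ⟨_ | k, rfl⟩ := (optionSkip i).surjective j
  · exact Or.inl rfl
  · exact Or.inr ⟨k, rfl⟩

theorem perm_ext_skip {σ τ : Perm ℕ} (k : ℕ) (h : σ k = τ k)
    (h' : ∀ j, σ (skip k j) = τ (skip k j)) : σ = τ := by
  ext j
  rcases eq_or_exists_eq_skip k j with rfl | ⟨j, rfl⟩
  · exact h
  · exact h' j

/-- The permutation that maps `k` to `i` and whose one-line notation without the entry at position
`k` flattens to that of `w`. -/
def insertEntry (k i : ℕ) (w : Perm ℕ) : Perm ℕ :=
  (optionSkip k).symm.trans ((optionCongr w).trans (optionSkip i))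

@[simp] theorem insertEntry_self (k i : ℕ) (w : Perm ℕ) : insertEntry k i w k = i := by
  have h : (optionSkip k).symm k = none := (optionSkip k).symm_apply_apply none
  simp only [insertEntry, trans_apply, h]
  rfl

@[simp] theorem insertEntry_skip (k i : ℕ) (w : Perm ℕ) (j : ℕ) :
    insertEntry k i w (skip k j) = skip i (w j) := by
  have h : (optionSkip k).symm (skip k j) = some j := (optionSkip k).symm_apply_apply (some j)
  simp only [insertEntry, trans_apply, h]
  rfl

theorem insertEntry_mul_insertEntry (l k i : ℕ) (v w : Perm ℕ) :
    insertEntry k i v * insertEntry l k w = insertEntry l i (v * w) :=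
  perm_ext_skip l (by simp) (by simp)

theorem insertEntry_one (i : ℕ) : insertEntry i i 1 = 1 := perm_ext_skip i (by simp) (by simp)

theorem insertEntry_swap (i a b : ℕ) : insertEntry i i (swap a b) = swap (skip i a) (skip i b) := by
  refine perm_ext_skip i ?_ fun j => ?_
  · rw [insertEntry_self, swap_apply_of_ne_of_ne (skip_ne _ _).symm (skip_ne _ _).symm]
  · rw [insertEntry_skip, (skip_strictMono i).injective.swap_apply]

theorem insertEntry_mul_swap (k i : ℕ) (w : Perm ℕ) (a b : ℕ) :
    insertEntry k i w * swap (skip k a) (skip k b) = insertEntry k i (w * swap a b) := by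
  rw [← insertEntry_swap, insertEntry_mul_insertEntry]

theorem insertEntry_self_mul_swap (i : ℕ) (w : Perm ℕ) :
    insertEntry i i w * swap i (i + 1) = insertEntry (i + 1) i w := by
  have h : swap i (i + 1) = insertEntry (i + 1) i 1 := by
    refine perm_ext_skip (i + 1) (by simp) fun j => ?_
    rw [insertEntry_skip, Perm.one_apply]
    rcases lt_trichotomy j i with hj | rfl | hj
    · rw [skip_of_lt hj, skip_of_lt (by omega), swap_apply_of_ne_of_ne] <;> omega
    · rw [skip_of_lt j.lt_succ_self, skip_of_le le_rfl, swap_apply_left]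
    · rw [skip_of_le (show i + 1 ≤ j from hj), skip_of_le hj.le, swap_apply_of_ne_of_ne] <;> omega
  rw [h, insertEntry_mul_insertEntry, mul_one]

theorem exists_eq_insertEntry {σ : Perm ℕ} {k i : ℕ} (h : σ k = i) :
    ∃ w, σ = insertEntry k i w := by
  let e : Option ℕ ≃ Option ℕ := (optionSkip k).trans (σ.trans (optionSkip i).symm)
  have he : e none = none := by
    rw [trans_apply, trans_apply, symm_apply_eq]
    exact h
  refine ⟨removeNone e, perm_ext_skip k (by rw [h, insertEntry_self]) fun j => ?_⟩
  have hj : some (removeNone e j) = (optionSkip i).symm (σ (skip k j)) := by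
    rw [removeNone_some e (Option.ne_none_iff_exists'.mp fun hc =>
      Option.some_ne_none j (e.injective (hc.trans he.symm)))]
    rfl
  rw [insertEntry_skip]
  exact ((symm_apply_eq _).mp hj.symm)

theorem insertEntry_apply_of_le {n k i : ℕ} {w : Perm ℕ} (hk : k ≤ n) (hi : i ≤ n) :
    (∀ j, n + 1 ≤ j → insertEntry k i w j = j) ↔ ∀ j, n ≤ j → w j = j := by
  refine ⟨fun h j hj => ?_, fun h j hj => ?_⟩
  · have := h (skip k j) (by rw [skip_of_le (hk.trans hj)]; omega)
    rw [insertEntry_skip, skip_of_le (hk.trans hj), ← skip_of_le (hi.trans hj)] at this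
    exact (skip_strictMono i).injective this
  · obtain ⟨j, rfl⟩ : ∃ m, j = m + 1 := ⟨j - 1, by omega⟩
    have hj : n ≤ j := by omega
    rw [← skip_of_le (hk.trans hj), insertEntry_skip, h j hj, skip_of_le (hi.trans hj),
      skip_of_le (hk.trans hj)]

/-! ### Noncrossing permutations in one-line notation -/

/-- The noncrossing property in terms of the values of the permutation, without reference to its
cycles: for each descending step `j ↦ σ j` the open interval `(σ j, j)` is stable under `σ`, and for
each ascending step `j ↦ σ j` the closed interval `[j, σ j]` is. -/
def IsNC (σ : Perm ℕ) : Prop :=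
  (∀ j k, σ j < k → k < j → σ j < σ k ∧ σ k < j) ∧
    ∀ j k, j ≤ k → k ≤ σ j → j ≤ σ k ∧ σ k ≤ σ j

theorem isNC_one : IsNC 1 := by
  constructor <;> intro j k <;> simp only [Perm.one_apply] <;> omega

theorem isNC_insertEntry_iff {i k : ℕ} (hk : k = i ∨ k = i + 1) {w : Perm ℕ} :
    IsNC (insertEntry k i w) ↔ IsNC w := by
  have lt_iff : ∀ {a b}, skip i a < skip k b ↔ a < b := fun {a b} => by
    unfold skip; split_ifs <;> omega
  have le_iff : ∀ {a b}, skip k a ≤ skip i b ↔ a ≤ b := fun {a b} => by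
    unfold skip; split_ifs <;> omega
  have lt_iff_self : ∀ {l a b}, skip l a < skip l b ↔ a < b := skip_lt_skip_iff
  have le_iff_self : ∀ {l a b}, skip l a ≤ skip l b ↔ a ≤ b := (skip_strictMono _).le_iff_le
  refine ⟨fun ⟨hdesc, hasc⟩ => ⟨fun a b => ?_, fun a b => ?_⟩,
    fun ⟨hdesc, hasc⟩ => ⟨fun j m => ?_, fun j m => ?_⟩⟩
  · simpa only [insertEntry_skip, lt_iff, lt_iff_self] using hdesc (skip k a) (skip k b)
  · simpa only [insertEntry_skip, le_iff, le_iff_self] using hasc (skip k a) (skip k b)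
  · rcases eq_or_exists_eq_skip k j with rfl | ⟨a, rfl⟩
    · rw [insertEntry_self]; omega
    · rcases eq_or_exists_eq_skip k m with rfl | ⟨b, rfl⟩
      · have := skip_ne i (w a)
        rw [insertEntry_self, insertEntry_skip]; omega
      · simpa only [insertEntry_skip, lt_iff, lt_iff_self] using hdesc a b
  · rcases eq_or_exists_eq_skip k j with rfl | ⟨a, rfl⟩
    · rw [insertEntry_self]
      intro hjm hmi
      obtain rfl : m = j := by omega
      rw [insertEntry_self]; omega
    · rcases eq_or_exists_eq_skip k m with rfl | ⟨b, rfl⟩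
      · have := skip_ne m a
        rw [insertEntry_self, insertEntry_skip]; omega
      · simpa only [insertEntry_skip, le_iff, le_iff_self] using hasc a b

/-! ### Inserting an adjacent descent -/

/-- The position, `i` or `i + 1`, at which inserting the value `i` into `w` creates a descent
between the positions `i` and `i + 1`. -/
def growPos (i : ℕ) (w : Perm ℕ) : ℕ := if w i < i then i else i + 1

/-- The permutation obtained from `w` by inserting the value `i` at one of the positions `i` and
`i + 1`, so that there is a descent between them. On noncrossing permutations this corresponds to
attaching to a forest a terminal node with left leaf `i`. -/
def grow (i : ℕ) (w : Perm ℕ) : Perm ℕ := insertEntry (growPos i w) i w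

theorem growPos_eq_or (i : ℕ) (w : Perm ℕ) : growPos i w = i ∨ growPos i w = i + 1 := by
  unfold growPos; split_ifs <;> simp

theorem growPos_eq_self_iff {i : ℕ} {w : Perm ℕ} : growPos i w = i ↔ w i < i := by
  unfold growPos; split_ifs <;> simp [*]

theorem grow_descent (i : ℕ) (w : Perm ℕ) : grow i w (i + 1) < grow i w i := by
  unfold grow growPos
  split_ifs with h
  · have hsucc : insertEntry i i w (i + 1) = skip i (w i) := by
      rw [← insertEntry_skip, skip_of_le le_rfl]
    rwa [hsucc, insertEntry_self, skip_of_lt h]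
  · have hself : insertEntry (i + 1) i w i = skip i (w i) := by
      rw [← insertEntry_skip, skip_of_lt i.lt_succ_self]
    rw [hself, insertEntry_self, skip_of_le (not_lt.mp h)]
    omega

theorem exists_eq_grow {σ : Perm ℕ} {i : ℕ} (hd : σ (i + 1) < σ i) (hi : σ i = i ∨ σ (i + 1) = i) :
    ∃ w, σ = grow i w := by
  rcases hi with hi | hi
  · obtain ⟨w, rfl⟩ := exists_eq_insertEntry hi
    rw [← skip_of_le (le_refl i), insertEntry_skip, insertEntry_self] at hd
    have hw : w i < i := by
      by_contra! hw
      rw [skip_of_le hw] at hd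
      omega
    exact ⟨w, by rw [grow, growPos_eq_self_iff.mpr hw]⟩
  · obtain ⟨w, rfl⟩ := exists_eq_insertEntry hi
    have hself : insertEntry (i + 1) i w i = skip i (w i) := by
      rw [← insertEntry_skip, skip_of_lt i.lt_succ_self]
    rw [hself, insertEntry_self] at hd
    have hw : ¬ w i < i := fun hw => by
      rw [skip_of_lt hw] at hd
      omega
    exact ⟨w, by rw [grow, growPos, if_neg hw]⟩

/-- The permutations `σ` and `σ s_i`, for `σ = grow i w`, are obtained from `w` by inserting `i` at
the two positions `i` and `i + 1`. -/
theorem exists_grow_mul_swap_eq (i : ℕ) (w : Perm ℕ) :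
    ∃ k, (k = i ∨ k = i + 1) ∧ grow i w * swap i (i + 1) = insertEntry k i w := by
  rcases growPos_eq_or i w with h | h
  · exact ⟨i + 1, Or.inr rfl, by rw [grow, h, insertEntry_self_mul_swap]⟩
  · exact ⟨i, Or.inl rfl, by rw [grow, h, ← insertEntry_self_mul_swap, mul_swap_mul_self]⟩

theorem isNC_grow_iff {i : ℕ} {w : Perm ℕ} : IsNC (grow i w) ↔ IsNC w :=
  isNC_insertEntry_iff (growPos_eq_or i w)

theorem isNC_grow_mul_swap_iff {i : ℕ} {w : Perm ℕ} :
    IsNC (grow i w * swap i (i + 1)) ↔ IsNC w := by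
  obtain ⟨k, hk, h⟩ := exists_grow_mul_swap_eq i w
  rw [h, isNC_insertEntry_iff hk]

theorem apply_eq_self_of_apply_le {σ : Perm ℕ} {S : Set ℕ} (hS : Set.MapsTo σ S S)
    (hle : ∀ k ∈ S, σ k ≤ k) {k : ℕ} (hk : k ∈ S) : σ k = k := by
  induction k using Nat.strong_induction_on with
  | _ k ih =>
    rcases (hle k hk).lt_or_eq with hlt | heq
    · exact σ.injective (ih _ hlt (hS hk))
    · exact heq

theorem IsNC.lt_of_lt_apply {σ : Perm ℕ} (h : IsNC σ) {j p : ℕ} (hj : j < σ j) (hp : σ p = j) :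
    j < p := by
  rcases lt_trichotomy j p with hjp | rfl | hjp
  · exact hjp
  · omega
  · have := (h.2 p j hjp.le hp.ge).2
    omega

theorem IsNC.exists_eq_grow {σ : Perm ℕ} (h : IsNC σ) (hσ : σ ≠ 1) :
    ∃ i w, IsNC w ∧ σ = grow i w := by
  suffices ∃ i, σ (i + 1) < σ i ∧ (σ i = i ∨ σ (i + 1) = i) by
    obtain ⟨i, hd, hi⟩ := this
    obtain ⟨w, rfl⟩ := DoubleForest.exists_eq_grow hd hi
    exact ⟨i, w, isNC_grow_iff.mp h, rfl⟩
  have exists_ascent : ∃ j, j < σ j := by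
    by_contra! hle
    exact hσ (Equiv.ext fun j =>
      apply_eq_self_of_apply_le (Set.mapsTo_univ σ _) (fun k _ => hle k) (Set.mem_univ j))
  obtain ⟨j, hj, hmin⟩ := exists_minimalFor_of_wellFoundedLT (fun j => j < σ j)
    (fun j => σ.symm j - j) exists_ascent
  obtain ⟨p, hp⟩ : ∃ p, σ p = j := σ.surjective j
  have gap_le : ∀ m q, m < σ m → σ q = m → p - j ≤ q - m := by
    intro m q hm hq
    rw [← (symm_apply_eq σ).mpr hp.symm, ← (symm_apply_eq σ).mpr hq.symm]
    exact le_of_not_gt fun hlt => (hmin hm hlt.le).not_gt hlt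
  have hjp : j < p := h.lt_of_lt_apply hj hp
  have mapsTo : Set.MapsTo σ (Set.Ioo j p) (Set.Ioo j p) := fun m hm => by
    have := h.1 p m (hp ▸ hm.1) hm.2
    rwa [hp] at this
  have apply_le : ∀ m ∈ Set.Ioo j p, σ m ≤ m := by
    intro m ⟨hjm, hmp⟩
    by_contra! hm
    obtain ⟨q, hq⟩ : ∃ q, σ q = m := σ.surjective m
    have hmq : m < q := h.lt_of_lt_apply hm hq
    have hqp : q < p := by
      by_contra! hpq
      have hne : p ≠ q := by rintro rfl; omega
      have := (h.1 q p (by omega) (by omega)).1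
      omega
    have := gap_le m q hm hq
    omega
  rcases (show j + 1 ≤ p from hjp).eq_or_lt with rfl | hlt
  · exact ⟨j, by omega, Or.inr hp⟩
  · have hfix : σ (p - 1) = p - 1 :=
      apply_eq_self_of_apply_le mapsTo apply_le ⟨by omega, by omega⟩
    refine ⟨p - 1, ?_, Or.inl hfix⟩
    rw [show p - 1 + 1 = p by omega, hp, hfix]
    omega

/-! ### Noncrossing inversions -/

/-- The noncrossing inversions of a permutation. -/
def IsInv (σ : Perm ℕ) (a b : ℕ) : Prop := a < b ∧ IsNC (σ * swap a b) ∧ σ b < σ a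

theorem isInv_insertEntry_skip_iff {i k : ℕ} (hk : k = i ∨ k = i + 1) {w : Perm ℕ} {c d : ℕ} :
    IsInv (insertEntry k i w) (skip k c) (skip k d) ↔ IsInv w c d := by
  simp only [IsInv, insertEntry_mul_swap, isNC_insertEntry_iff hk, insertEntry_skip,
    skip_lt_skip_iff]

theorem IsInv.eq_of_left {i k b : ℕ} (hk : k = i ∨ k = i + 1) {σ : Perm ℕ}
    (hσ : σ k = i) (hd : σ (i + 1) < σ i) (h : IsInv σ k b) : k = i ∧ b = i + 1 := by
  obtain ⟨hkb, ⟨hdesc, -⟩, hb⟩ := h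
  rcases hk with rfl | rfl
  · refine ⟨rfl, ?_⟩
    by_contra hne
    have := hdesc b (k + 1) (by simp [hσ]) (by omega)
    rw [Perm.mul_apply, Perm.mul_apply, swap_apply_right,
      swap_apply_of_ne_of_ne (by omega) (by omega)] at this
    omega
  · have := hdesc (i + 1) i (by simpa [hσ] using hb) (by omega)
    rw [Perm.mul_apply (x := i), swap_apply_of_ne_of_ne (by omega) (by omega)] at this
    omega

theorem IsInv.eq_of_right {i k a : ℕ} (hk : k = i ∨ k = i + 1) {σ : Perm ℕ}
    (hσ : σ k = i) (hd : σ (i + 1) < σ i) (h : IsInv σ a k) : a = i ∧ k = i + 1 := by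
  obtain ⟨hak, ⟨-, hasc⟩, ha⟩ := h
  rcases hk with rfl | rfl
  · have := hasc a k hak.le (by simp [hσ])
    rw [Perm.mul_apply, Perm.mul_apply, swap_apply_right, swap_apply_left] at this
    omega
  · refine ⟨?_, rfl⟩
    by_contra hne
    have := hasc a i (by omega) (by simp [hσ])
    rw [Perm.mul_apply (x := i), swap_apply_of_ne_of_ne (Ne.symm hne) (by omega), Perm.mul_apply,
      swap_apply_left] at this
    omega

theorem isInv_grow_iff {i : ℕ} {w : Perm ℕ} (hw : IsNC w) {a b : ℕ} :
    IsInv (grow i w) a b ↔ (a = i ∧ b = i + 1) ∨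
      ∃ c d, a = skip (growPos i w) c ∧ b = skip (growPos i w) d ∧ IsInv w c d := by
  have hk := growPos_eq_or i w
  have hσ : grow i w (growPos i w) = i := insertEntry_self _ _ _
  have hd := grow_descent i w
  constructor
  · intro h
    rcases eq_or_exists_eq_skip (growPos i w) a with rfl | ⟨c, rfl⟩
    · exact Or.inl (h.eq_of_left hk hσ hd)
    rcases eq_or_exists_eq_skip (growPos i w) b with rfl | ⟨d, rfl⟩
    · exact Or.inl (h.eq_of_right hk hσ hd)
    exact Or.inr ⟨c, d, rfl, rfl, (isInv_insertEntry_skip_iff hk).mp h⟩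
  · rintro (⟨rfl, rfl⟩ | ⟨c, d, rfl, rfl, h⟩)
    · exact ⟨Nat.lt_succ_self _, isNC_grow_mul_swap_iff.mpr hw, hd⟩
    · exact (isInv_insertEntry_skip_iff hk).mpr h

/-! ### The Bruhat order -/

/-- The number of positions below `p` whose value is at least `q`. -/
def rk (σ : Perm ℕ) (p q : ℕ) : ℕ := ∑ j ∈ Finset.range p, if q ≤ σ j then 1 else 0

/-- The Bruhat order, defined by comparison of the rank functions. -/
def BruhatLE (v w : Perm ℕ) : Prop := ∀ p q, rk v p q ≤ rk w p q

theorem rk_succ (σ : Perm ℕ) (p q : ℕ) :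
    rk σ (p + 1) q = rk σ p q + if q ≤ σ p then 1 else 0 := Finset.sum_range_succ _ _

theorem rk_insertEntry (k i : ℕ) (w : Perm ℕ) (p q : ℕ) :
    rk (insertEntry k i w) p q = rk w (if p ≤ k then p else p - 1) (if q ≤ i then q else q - 1) +
      if k < p ∧ q ≤ i then 1 else 0 := by
  have le_skip : ∀ a, q ≤ skip i a ↔ (if q ≤ i then q else q - 1) ≤ a := fun a => by
    unfold skip; split_ifs <;> omega
  induction p with
  | zero => simp [rk]
  | succ p ih =>
    rw [rk_succ, ih]
    rcases lt_trichotomy p k with hp | rfl | hp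
    · have hval := insertEntry_skip k i w p
      rw [skip_of_lt hp] at hval
      simp only [hval, le_skip, if_pos hp.le, show p + 1 ≤ k by omega, if_true, rk_succ,
        show ¬ k < p by omega, show ¬ k < p + 1 by omega, false_and, if_false, add_zero]
    · simp
    · obtain ⟨m, rfl⟩ : ∃ m, p = m + 1 := ⟨p - 1, by omega⟩
      have hval := insertEntry_skip k i w m
      rw [skip_of_le (by omega)] at hval
      simp only [hval, le_skip, show ¬ m + 1 ≤ k by omega, show ¬ m + 1 + 1 ≤ k by omega, if_false,
        hp, show k < m + 1 + 1 by omega, Nat.add_sub_cancel, rk_succ]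
      ring

theorem BruhatLE.of_forall_ne {v w : Perm ℕ} {i : ℕ} (hd : w (i + 1) < w i)
    (h : ∀ p ≠ i + 1, ∀ q, rk v p q ≤ rk w p q) : BruhatLE v w := by
  intro p q
  by_cases hp : p = i + 1
  · subst hp
    have h_before := h i (by omega) q
    have h_after := h (i + 2) (by omega) q
    simp only [rk_succ] at h_after ⊢
    split_ifs at h_after ⊢ <;> omega
  · exact h p hp q

theorem BruhatLE.insertEntry_grow {v w : Perm ℕ} (h : BruhatLE v w) {i k : ℕ}
    (hk : k = i ∨ k = i + 1) : BruhatLE (insertEntry k i v) (grow i w) := by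
  refine BruhatLE.of_forall_ne (grow_descent i w) fun p hp q => ?_
  have hl := growPos_eq_or i w
  rw [grow, rk_insertEntry, rk_insertEntry]
  have h_le : p ≤ k ↔ p ≤ growPos i w := by omega
  have h_lt : k < p ↔ growPos i w < p := by omega
  simp only [h_le, h_lt]
  exact Nat.add_le_add_right (h _ _) _

theorem bruhatLE_grow_mul_swap (i : ℕ) (w : Perm ℕ) :
    BruhatLE (grow i w * swap i (i + 1)) (grow i w) := by
  obtain ⟨k, hk, h⟩ := exists_grow_mul_swap_eq i w
  exact h ▸ BruhatLE.insertEntry_grow (fun _ _ => le_rfl) hk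

theorem rk_mul_swap_lt {σ : Perm ℕ} {i : ℕ} (hd : σ (i + 1) < σ i) :
    rk (σ * swap i (i + 1)) (i + 1) (σ i) < rk σ (i + 1) (σ i) := by
  have h : rk (σ * swap i (i + 1)) i (σ i) = rk σ i (σ i) :=
    Finset.sum_congr rfl fun j hj => by
      have := Finset.mem_range.mp hj
      rw [Perm.mul_apply, swap_apply_of_ne_of_ne (by omega) (by omega)]
  rw [rk_succ, rk_succ, h]
  simp [hd]

end Permutations

section NoncrossingPartitions

open Equiv

/-! ### Products of backward cycles -/

theorem backCycle_apply_of_notMem {B : Finset ℕ} {a : ℕ} (h : a ∉ B) : backCycle B a = a :=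
  List.formPerm_apply_of_notMem (by simpa using h)

theorem backCycle_apply_mem {B : Finset ℕ} {a : ℕ} (h : a ∈ B) : backCycle B a ∈ B := by
  have := List.formPerm_apply_mem_of_mem (x := a) (l := B.sort (· ≥ ·)) (by simpa using h)
  exact (Finset.mem_sort _).mp this

/-- The order-theoretic description of a step `a ↦ b` of the backward cycle of `B`: either `b` is
the predecessor of `a` in `B`, or `a` is the minimum and `b` the maximum of `B`. -/
def IsBackStep (B : Finset ℕ) (a b : ℕ) : Prop :=
  (b < a ∧ ∀ c ∈ B, ¬ (b < c ∧ c < a)) ∨ ∀ c ∈ B, a ≤ c ∧ c ≤ b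

theorem isBackStep_backCycle {B : Finset ℕ} {a : ℕ} (h : a ∈ B) :
    IsBackStep B a (backCycle B a) := by
  unfold backCycle
  have hmem : ∀ c, c ∈ B ↔ c ∈ B.sort (· ≥ ·) := fun c => (Finset.mem_sort _).symm
  have hl : (B.sort (· ≥ ·)).SortedGT := B.sortedGT_sort
  generalize B.sort (· ≥ ·) = l at hmem hl
  obtain ⟨k, hk, rfl⟩ := List.getElem_of_mem ((hmem a).mp h)
  by_cases hsucc : k + 1 < l.length
  · rw [List.formPerm_apply_lt_getElem _ hl.nodup _ hsucc]
    refine Or.inl ⟨hl.getElem_lt_getElem_iff.mpr k.lt_succ_self, fun c hc => ?_⟩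
    obtain ⟨m, hm, rfl⟩ := List.getElem_of_mem ((hmem c).mp hc)
    rw [hl.getElem_lt_getElem_iff, hl.getElem_lt_getElem_iff]
    omega
  · have hlast : (k + 1) % l.length = 0 := by rw [show k + 1 = l.length by omega, Nat.mod_self]
    simp only [List.formPerm_apply_getElem _ hl.nodup, hlast]
    refine Or.inr fun c hc => ?_
    obtain ⟨m, hm, rfl⟩ := List.getElem_of_mem ((hmem c).mp hc)
    rw [hl.getElem_le_getElem_iff, hl.getElem_le_getElem_iff]
    omega

theorem IsBackStep.unique {B : Finset ℕ} {a b c : ℕ} (hb : b ∈ B) (hc : c ∈ B)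
    (hab : IsBackStep B a b) (hac : IsBackStep B a c) : b = c := by
  rcases hab with ⟨_, hab⟩ | hab <;> rcases hac with ⟨_, hac⟩ | hac <;>
  · have := hab c hc
    have := hac b hb
    omega

theorem prod_map_backCycle_of_notMem {l : List (Finset ℕ)} {a : ℕ} (h : ∀ B ∈ l, a ∉ B) :
    (l.map backCycle).prod a = a := by
  induction l with
  | nil => rfl
  | cons C l ih =>
    rw [List.map_cons, List.prod_cons, Perm.mul_apply,
      ih fun B hB => h B (List.mem_cons_of_mem _ hB),
      backCycle_apply_of_notMem (h C List.mem_cons_self)]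

theorem prod_map_backCycle_of_mem {l : List (Finset ℕ)} (hl : l.Pairwise Disjoint) {B : Finset ℕ}
    (hB : B ∈ l) {a : ℕ} (ha : a ∈ B) : (l.map backCycle).prod a = backCycle B a := by
  induction l with
  | nil => simp at hB
  | cons C l ih =>
    rw [List.pairwise_cons] at hl
    rw [List.map_cons, List.prod_cons, Perm.mul_apply]
    rcases List.mem_cons.mp hB with rfl | hB
    · rw [prod_map_backCycle_of_notMem fun D hD h => Finset.disjoint_left.mp (hl.1 D hD) ha h]
    · rw [ih hl.2 hB, backCycle_apply_of_notMem]
      exact fun h => Finset.disjoint_left.mp (hl.1 B hB) h (backCycle_apply_mem ha)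

theorem permOfBlocks_apply_of_notMem {P : Finset (Finset ℕ)} {a : ℕ} (h : ∀ B ∈ P, a ∉ B) :
    permOfBlocks P a = a :=
  prod_map_backCycle_of_notMem (by simpa using h)

theorem permOfBlocks_apply_of_mem {P : Finset (Finset ℕ)}
    (hP : (P : Set (Finset ℕ)).Pairwise Disjoint)
    {B : Finset ℕ} (hB : B ∈ P) {a : ℕ} (ha : a ∈ B) : permOfBlocks P a = backCycle B a := by
  refine prod_map_backCycle_of_mem ?_ (by simpa using hB) ha
  refine P.nodup_toList.pairwise_of_forall_ne fun C hC D hD h => ?_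
  exact hP (by simpa using hC) (by simpa using hD) h

/-! ### The two descriptions of noncrossing permutations -/

theorem lt_of_mem_part {n : ℕ} {P : Finpartition (Finset.range n)} {B : Finset ℕ}
    (hB : B ∈ P.parts) {a : ℕ} (ha : a ∈ B) : a < n :=
  Finset.mem_range.mp (P.le hB ha)

theorem permOfBlocks_parts_apply_of_le {n : ℕ} (P : Finpartition (Finset.range n)) {a : ℕ}
    (ha : n ≤ a) : permOfBlocks P.parts a = a :=
  permOfBlocks_apply_of_notMem fun _ hB haB => ha.not_gt (lt_of_mem_part hB haB)

theorem exists_isBackStep_permOfBlocks {n : ℕ} (P : Finpartition (Finset.range n)) {a : ℕ}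
    (ha : a < n) : ∃ B ∈ P.parts, a ∈ B ∧ permOfBlocks P.parts a ∈ B ∧
      IsBackStep B a (permOfBlocks P.parts a) := by
  obtain ⟨B, hB, haB⟩ := P.exists_mem (Finset.mem_range.mpr ha)
  rw [permOfBlocks_apply_of_mem P.disjoint hB haB]
  exact ⟨B, hB, haB, backCycle_apply_mem haB, isBackStep_backCycle haB⟩

theorem IsNoncrossing.mem_Ioo {n : ℕ} {P : Finpartition (Finset.range n)} (hP : IsNoncrossing P)
    {B C : Finset ℕ} (hB : B ∈ P.parts) (hC : C ∈ P.parts) {a b c d : ℕ} (ha : a ∈ B) (hb : b ∈ B)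
    (hc : c ∈ C) (hd : d ∈ C) (hcB : c ∉ B) (hac : a < c) (hcb : c < b) : a < d ∧ d < b := by
  have hBC : B ≠ C := fun h => hcB (h ▸ hc)
  have hdB : d ∉ B := fun h => Finset.disjoint_left.mp (P.disjoint hB hC hBC) h hd
  have hda : d ≠ a := fun h => hdB (h ▸ ha)
  have hdb : d ≠ b := fun h => hdB (h ▸ hb)
  have := hP C hC B hB hBC.symm d hd c hc a ha b hb
  have := hP B hB C hC hBC a ha b hb c hc d hd
  omega

theorem isNC_permOfBlocks {n : ℕ} {P : Finpartition (Finset.range n)} (hP : IsNoncrossing P) :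
    IsNC (permOfBlocks P.parts) := by
  have fixed : ∀ a, n ≤ a → permOfBlocks P.parts a = a := fun _ => permOfBlocks_parts_apply_of_le P
  refine ⟨fun j k hk hkj => ?_, fun j k hjk hk => ?_⟩
  · have hj : j < n := by
      by_contra! hj
      have := fixed j hj
      omega
    obtain ⟨B, hB, hjB, hsB, hstep⟩ := exists_isBackStep_permOfBlocks P hj
    obtain ⟨C, hC, hkC, htC, -⟩ := exists_isBackStep_permOfBlocks P (hkj.trans hj)
    rcases hstep with ⟨-, hpred⟩ | hmin
    · exact hP.mem_Ioo hB hC hsB hjB hkC htC (fun hkB => hpred k hkB ⟨hk, hkj⟩) hk hkj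
    · have := hmin j hjB
      omega
  · rcases Nat.lt_or_ge j n with hj | hj
    · obtain ⟨B, hB, hjB, hsB, hstep⟩ := exists_isBackStep_permOfBlocks P hj
      have hmin : ∀ c ∈ B, j ≤ c ∧ c ≤ permOfBlocks P.parts j :=
        hstep.resolve_left fun h => by omega
      obtain ⟨C, hC, hkC, htC, -⟩ :=
        exists_isBackStep_permOfBlocks P (hk.trans_lt (lt_of_mem_part hB hsB))
      by_cases hkB : k ∈ B
      · obtain rfl := P.disjoint.elim_finset hB hC k hkB hkC
        exact hmin _ htC
      · have hjk' : j < k := lt_of_le_of_ne hjk fun h => hkB (h ▸ hjB)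
        have hk' : k < permOfBlocks P.parts j := lt_of_le_of_ne hk fun h => hkB (h ▸ hsB)
        have := hP.mem_Ioo hB hC hjB hsB hkC htC hkB hjk' hk'
        omega
    · obtain rfl : j = k := le_antisymm hjk (by rwa [fixed j hj] at hk)
      rw [fixed j hj]
      omega

theorem mem_of_sameCycle_of_mapsTo {α : Type*} {σ : Perm α} {S : Set α} (hS : S.Finite)
    (h : Set.MapsTo σ S S) {a b : α} (ha : a ∈ S) (hab : σ.SameCycle a b) : b ∈ S := by
  obtain ⟨m, rfl⟩ := hab
  exact (((hS.injOn_iff_bijOn_of_mapsTo h).mp σ.injective.injOn).perm_zpow m).mapsTo ha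

theorem IsNC.mem_Ioo_of_sameCycle {σ : Perm ℕ} (h : IsNC σ) {a c d : ℕ}
    (hc : c ∈ Set.Ioo (σ a) a) (hcd : σ.SameCycle c d) : d ∈ Set.Ioo (σ a) a :=
  mem_of_sameCycle_of_mapsTo (Set.finite_Ioo _ _) (fun k hk => h.1 a k hk.1 hk.2) hc hcd

theorem IsNC.isBackStep {σ : Perm ℕ} (h : IsNC σ) {B : Finset ℕ} {a : ℕ}
    (hB : ∀ b ∈ B, σ.SameCycle a b) : IsBackStep B a (σ a) := by
  rcases Nat.lt_or_ge (σ a) a with hlt | hle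
  · exact Or.inl ⟨hlt, fun c hc hcc =>
      absurd (h.mem_Ioo_of_sameCycle hcc (hB c hc).symm).2 (lt_irrefl _)⟩
  · exact Or.inr fun c hc => mem_of_sameCycle_of_mapsTo (S := Set.Icc a (σ a)) (Set.finite_Icc _ _)
      (fun k hk => h.2 a k hk.1 hk.2) ⟨le_rfl, hle⟩ (hB c hc)

theorem IsNC.lt_of_sameCycle {σ : Perm ℕ} (h : IsNC σ) {a b c d : ℕ} (hab : σ.SameCycle a b)
    (hcd : σ.SameCycle c d) (hac : ¬ σ.SameCycle a c) (h_lt : a < c) (h_lt' : c < b) : d < b := by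
  classical
  have hex : ∃ e, σ.SameCycle a e ∧ c < e := ⟨b, hab, h_lt'⟩
  obtain ⟨e, ⟨hae, hce⟩, hmin⟩ : ∃ e, (σ.SameCycle a e ∧ c < e) ∧
      ∀ k, σ.SameCycle a k → c < k → e ≤ k :=
    ⟨Nat.find hex, Nat.find_spec hex, fun k hk hck => Nat.find_min' hex ⟨hk, hck⟩⟩
  have hcne : σ e ≠ c := fun heq => hac (heq ▸ Perm.sameCycle_apply_right.mpr hae)
  have hσe := hmin (σ e) (Perm.sameCycle_apply_right.mpr hae)
  have heb := hmin b hab h_lt'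
  rcases h.isBackStep (B := {a}) (a := e) (by simpa using hae.symm) with ⟨hlt, -⟩ | hle
  · have := (h.mem_Ioo_of_sameCycle (a := e) ⟨by omega, hce⟩ hcd).2
    omega
  · have := hle a (Finset.mem_singleton_self a)
    omega

/-- The partition of `[n]` into the parts of the cycles of `σ`. -/
noncomputable def cyclePartition (σ : Perm ℕ) (n : ℕ) : Finpartition (Finset.range n) :=
  haveI := Classical.decRel (Perm.SameCycle.setoid σ)
  Finpartition.ofSetSetoid (Perm.SameCycle.setoid σ) _

theorem mem_cyclePartition_part_iff {σ : Perm ℕ} {n : ℕ} {B : Finset ℕ}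
    (hB : B ∈ (cyclePartition σ n).parts) {a b : ℕ} (ha : a ∈ B) :
    b ∈ B ↔ b < n ∧ σ.SameCycle a b := by
  rw [← (cyclePartition σ n).part_eq_of_mem hB ha]
  unfold cyclePartition
  rw [Finpartition.mem_part_ofSetSetoid_iff_rel]
  simp only [Finset.mem_range, lt_of_mem_part hB ha, true_and]
  rfl

theorem IsNC.isNoncrossing_cyclePartition {σ : Perm ℕ} (h : IsNC σ) (n : ℕ) :
    IsNoncrossing (cyclePartition σ n) := by
  rintro B hB C hC hBC a ha b hb c hc d hd ⟨hac, hcb, hbd⟩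
  refine (h.lt_of_sameCycle ((mem_cyclePartition_part_iff hB ha).mp hb).2
    ((mem_cyclePartition_part_iff hC hc).mp hd).2 (fun hsame => ?_) hac hcb).not_gt hbd
  exact Finset.disjoint_left.mp ((cyclePartition σ n).disjoint hB hC hBC)
    ((mem_cyclePartition_part_iff hB ha).mpr ⟨lt_of_mem_part hC hc, hsame⟩) hc

theorem apply_lt_of_fixed {σ : Perm ℕ} {n : ℕ} (hn : ∀ a, n ≤ a → σ a = a) {a : ℕ} (ha : a < n) :
    σ a < n := by
  by_contra! hc
  have := σ.injective (hn (σ a) hc)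
  omega

theorem IsNC.eq_permOfBlocks {σ : Perm ℕ} (h : IsNC σ) {n : ℕ} (hn : ∀ a, n ≤ a → σ a = a) :
    σ = permOfBlocks (cyclePartition σ n).parts := by
  ext a
  rcases Nat.lt_or_ge a n with ha | ha
  · obtain ⟨B, hB, haB, hsB, hstep⟩ := exists_isBackStep_permOfBlocks (cyclePartition σ n) ha
    have hσB : σ a ∈ B := (mem_cyclePartition_part_iff hB haB).mpr
      ⟨apply_lt_of_fixed hn ha, Perm.sameCycle_apply_right.mpr (Perm.SameCycle.refl _ _)⟩
    exact (h.isBackStep fun b hb => ((mem_cyclePartition_part_iff hB haB).mp hb).2).unique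
      hσB hsB hstep
  · rw [hn a ha, permOfBlocks_parts_apply_of_le _ ha]

theorem mem_NC_iff {n : ℕ} {σ : Perm ℕ} : σ ∈ NC n ↔ IsNC σ ∧ ∀ a, n ≤ a → σ a = a := by
  constructor
  · rintro ⟨P, hP, rfl⟩
    exact ⟨isNC_permOfBlocks hP, fun _ => permOfBlocks_parts_apply_of_le P⟩
  · rintro ⟨h, hn⟩
    exact ⟨_, h.isNoncrossing_cyclePartition n, h.eq_permOfBlocks hn⟩

theorem mem_invNC_iff {n : ℕ} {σ : Perm ℕ} (hn : ∀ a, n ≤ a → σ a = a) {p : ℕ × ℕ} :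
    p ∈ invNC n σ ↔ IsInv σ p.1 p.2 := by
  simp only [invNC, Finset.mem_filter, Finset.mem_product, Finset.mem_range, mem_NC_iff, IsInv]
  constructor
  · rintro ⟨-, hlt, ⟨hNC, -⟩, hinv⟩
    exact ⟨hlt, hNC, hinv⟩
  · rintro ⟨hlt, hNC, hinv⟩
    have hp : p.2 < n := by
      by_contra! hp
      have hval := hn p.2 hp
      have := σ.injective (hn (σ p.1) (by omega))
      omega
    refine ⟨⟨hlt.trans hp, hp⟩, hlt, ⟨hNC, fun a ha => ?_⟩, hinv⟩
    rw [Perm.mul_apply, swap_apply_of_ne_of_ne (by omega) (by omega), hn a ha]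

end NoncrossingPartitions

section Trees

/-! ### Terminal nodes of a tree -/

/-- `i` is the left leaf of a terminal node of the tree whose leaves are `a, a + 1, …`. -/
def IsTerm : PlaneTree → ℕ → ℕ → Prop
  | .nil, _, _ => False
  | .node _ l r, a, i =>
      (l = .nil ∧ r = .nil ∧ i = a) ∨ IsTerm l a i ∨ IsTerm r (a + l.numLeaves) i

theorem IsTerm.mem_Ico {T : PlaneTree} {a i : ℕ} (h : IsTerm T a i) :
    a ≤ i ∧ i < a + T.numNodes := by
  induction T generalizing a with
  | nil => exact h.elim
  | node _ l r ihl ihr =>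
    rw [BinaryTree.numNodes]
    rcases h with ⟨rfl, rfl, rfl⟩ | h | h
    · simp
    · have := ihl h
      omega
    · have := ihr h
      have := l.numLeaves_eq_numNodes_succ
      omega

theorem IsTerm.ne_nil {T : PlaneTree} {a i : ℕ} (h : IsTerm T a i) : T ≠ .nil := by
  rintro rfl
  exact h

theorem exists_isTerm {T : PlaneTree} (h : T ≠ .nil) (a : ℕ) : ∃ i, IsTerm T a i := by
  induction T generalizing a with
  | nil => exact absurd rfl h
  | node _ l r ihl ihr =>
    by_cases hl : l = .nil
    · by_cases hr : r = .nil
      · exact ⟨a, Or.inl ⟨hl, hr, rfl⟩⟩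
      · exact (ihr hr _).imp fun _ hi => Or.inr (Or.inr hi)
    · exact (ihl hl a).imp fun _ hi => Or.inr (Or.inl hi)

theorem trimTree_of_not_isTerm {T : PlaneTree} {a i : ℕ} (h : ¬ IsTerm T a i) :
    trimTree T a i = T := by
  induction T generalizing a with
  | nil => rfl
  | node _ l r ihl ihr =>
    simp only [IsTerm, not_or] at h
    rw [trimTree, if_neg h.1, ihl h.2.1, ihr h.2.2]

theorem trimTree_node_nil (a : ℕ) : trimTree (.node () .nil .nil) a a = .nil := by
  simp [trimTree]

theorem trimTree_node_left {l r : PlaneTree} {a i : ℕ} (h : IsTerm l a i) :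
    trimTree (.node () l r) a i = .node () (trimTree l a i) r := by
  have hr : ¬ IsTerm r (a + l.numLeaves) i := fun hr => by
    have := hr.mem_Ico
    have := h.mem_Ico
    have := l.numLeaves_eq_numNodes_succ
    omega
  rw [trimTree, if_neg fun hc => h.ne_nil hc.1, trimTree_of_not_isTerm hr]

theorem trimTree_node_right {l r : PlaneTree} {a i : ℕ} (h : IsTerm r (a + l.numLeaves) i) :
    trimTree (.node () l r) a i = .node () l (trimTree r (a + l.numLeaves) i) := by
  have hl : ¬ IsTerm l a i := fun hl => by
    have := hl.mem_Ico
    have := h.mem_Ico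
    have := l.numLeaves_eq_numNodes_succ
    omega
  rw [trimTree, if_neg fun hc => h.ne_nil hc.2.1, trimTree_of_not_isTerm hl]

theorem numNodes_trimTree {T : PlaneTree} {a i : ℕ} (h : IsTerm T a i) :
    (trimTree T a i).numNodes + 1 = T.numNodes := by
  induction T generalizing a with
  | nil => exact h.elim
  | node _ l r ihl ihr =>
    rcases h with ⟨rfl, rfl, rfl⟩ | h | h
    · simp [trimTree]
    · rw [trimTree_node_left h, BinaryTree.numNodes, BinaryTree.numNodes, ← ihl h]
      omega
    · rw [trimTree_node_right h, BinaryTree.numNodes, BinaryTree.numNodes, ← ihr h]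
      omega

theorem numLeaves_trimTree {T : PlaneTree} {a i : ℕ} (h : IsTerm T a i) :
    (trimTree T a i).numLeaves + 1 = T.numLeaves := by
  rw [BinaryTree.numLeaves_eq_numNodes_succ, numNodes_trimTree h,
    BinaryTree.numLeaves_eq_numNodes_succ]

theorem eq_of_trimTree_eq_nil {T : PlaneTree} {a i : ℕ} (h : IsTerm T a i)
    (hT : trimTree T a i = .nil) : i = a := by
  have hcard := numNodes_trimTree h
  rw [hT, BinaryTree.numNodes] at hcard
  have := h.mem_Ico
  omega

theorem isTerm_succ {T : PlaneTree} {a i : ℕ} : IsTerm T (a + 1) (i + 1) ↔ IsTerm T a i := by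
  induction T generalizing a with
  | nil => rfl
  | node _ l r ihl ihr =>
    simp only [IsTerm, add_right_comm a 1, ihl, ihr, Nat.add_right_cancel_iff]

theorem trimTree_succ (T : PlaneTree) (a i : ℕ) : trimTree T (a + 1) (i + 1) = trimTree T a i := by
  induction T generalizing a with
  | nil => rfl
  | node _ l r ihl ihr =>
    simp only [trimTree, add_right_comm a 1, ihl, ihr, Nat.add_right_cancel_iff]

theorem isTerm_succ_skip_iff {T : PlaneTree} {a k : ℕ} (hk : k ≤ a) {j : ℕ} :
    IsTerm T (a + 1) (skip k j) ↔ IsTerm T a j := by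
  rcases lt_or_ge j k with hj | hj
  · rw [skip_of_lt hj]
    constructor <;> intro h <;> have := h.mem_Ico <;> omega
  · rw [skip_of_le hj, isTerm_succ]

theorem isTerm_skip_iff {T : PlaneTree} {a k : ℕ} (hk : a + T.numNodes ≤ k) {j : ℕ} :
    IsTerm T a (skip k j) ↔ IsTerm T a j := by
  rcases lt_or_ge j k with hj | hj
  · rw [skip_of_lt hj]
  · rw [skip_of_le hj]
    constructor <;> intro h <;> have := h.mem_Ico <;> omega

/-- For `j = k - 1`, trimming at `k` may create a new terminal node. -/
theorem isTerm_trimTree_iff {T : PlaneTree} {a k j : ℕ} (h : IsTerm T a k) (hjk : j ≠ k)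
    (hjk' : j + 1 ≠ k) : IsTerm (trimTree T a k) a j ↔ IsTerm T a (skip k j) := by
  induction T generalizing a with
  | nil => exact h.elim
  | node _ l r ihl ihr =>
    have hl := l.numLeaves_eq_numNodes_succ
    rcases h with ⟨rfl, rfl, rfl⟩ | h | h
    · simp [trimTree, IsTerm, skip_ne]
    · have hk := h.mem_Ico
      have hroot : ¬ (trimTree l a k = .nil ∧ r = .nil ∧ j = a) := fun hc =>
        hjk (hc.2.2.trans (eq_of_trimTree_eq_nil h hc.1).symm)
      have hcard := numLeaves_trimTree h
      rw [trimTree_node_left h, IsTerm, IsTerm, ihl h, ← hcard, ← add_assoc,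
        isTerm_succ_skip_iff (by omega)]
      simp only [hroot, h.ne_nil, false_and]
    · have hk := h.mem_Ico
      have hroot : ¬ (l = .nil ∧ trimTree r (a + l.numLeaves) k = .nil ∧ j = a) := by
        rintro ⟨rfl, hr, rfl⟩
        exact hjk' (eq_of_trimTree_eq_nil h hr).symm
      rw [trimTree_node_right h, IsTerm, IsTerm, ihr h, isTerm_skip_iff (T := l) (by omega)]
      simp only [hroot, h.ne_nil, false_and, and_false]

theorem trimTree_comm {T : PlaneTree} {a k i : ℕ} (hk : IsTerm T a k) (hi : IsTerm T a (i + 1))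
    (hki : k < i) :
    trimTree (trimTree T a k) a i = trimTree (trimTree T a (i + 1)) a k := by
  have isTerm_trim_lt : ∀ {T : PlaneTree} {a}, IsTerm T a k → IsTerm T a (i + 1) →
      IsTerm (trimTree T a k) a i := fun hk hi => by
    rwa [isTerm_trimTree_iff hk (by omega) (by omega), skip_of_le hki.le]
  have isTerm_trim_gt : ∀ {T : PlaneTree} {a}, IsTerm T a k → IsTerm T a (i + 1) →
      IsTerm (trimTree T a (i + 1)) a k := fun hk hi => by
    rwa [isTerm_trimTree_iff hi (by omega) (by omega), skip_of_lt (by omega)]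
  induction T generalizing a with
  | nil => exact hk.elim
  | node _ l r ihl ihr =>
    rcases hk with ⟨rfl, rfl, rfl⟩ | hk | hk <;> rcases hi with ⟨hl, hr, hia⟩ | hi | hi
    · omega
    · exact hi.elim
    · exact hi.elim
    · exact absurd hl hk.ne_nil
    · rw [trimTree_node_left hk, trimTree_node_left hi, trimTree_node_left (isTerm_trim_lt hk hi),
        trimTree_node_left (isTerm_trim_gt hk hi), ihl hk hi]
    · have hstart : a + l.numLeaves = a + (trimTree l a k).numLeaves + 1 := by
        rw [← numLeaves_trimTree hk, add_assoc]
      have hi' : IsTerm r (a + (trimTree l a k).numLeaves) i := by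
        rwa [hstart, isTerm_succ] at hi
      rw [trimTree_node_left hk, trimTree_node_right hi, trimTree_node_left hk,
        trimTree_node_right hi', hstart, trimTree_succ]
    · exact absurd hr hk.ne_nil
    · have := hk.mem_Ico
      have := hi.mem_Ico
      have := l.numLeaves_eq_numNodes_succ
      omega
    · rw [trimTree_node_right hk, trimTree_node_right hi,
        trimTree_node_right (isTerm_trim_lt hk hi), trimTree_node_right (isTerm_trim_gt hk hi),
        ihr hk hi]

end Trees

section TreePermutations

open Equiv

/-! ### The noncrossing permutation of a tree -/

/-- The contribution of a node to the permutation of a tree; nodes that are right children are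
deleted and do not contribute. -/
def rootSwap (isRight : Bool) (p q : ℕ) : Perm ℕ := if isRight then 1 else swap p q

/-- The product of the backward cycles of the trees into which `LTree.cut` splits a tree with
leaves `a, a + 1, …`. -/
def treePerm : (isRight : Bool) → PlaneTree → ℕ → Perm ℕ
  | _, .nil, _ => 1
  | b, .node _ l r, a =>
      rootSwap b (a + l.numNodes) (a + l.numLeaves + r.numNodes) *
        (treePerm false l a * treePerm true r (a + l.numLeaves))

theorem rootSwap_apply_of_ne (b : Bool) {p q j : ℕ} (hp : j ≠ p) (hq : j ≠ q) :
    rootSwap b p q j = j := by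
  cases b
  · exact swap_apply_of_ne_of_ne hp hq
  · rfl

theorem rootSwap_apply_lt_iff (b : Bool) {i p q j : ℕ} (hp : i ≤ p) (hq : i ≤ q) :
    rootSwap b p q j < i ↔ j < i := by
  by_cases hj : j = p ∨ j = q
  · cases b <;> rcases hj with rfl | rfl <;> simp [rootSwap] <;> omega
  · rw [not_or] at hj
    rw [rootSwap_apply_of_ne b hj.1 hj.2]

theorem insertEntry_rootSwap (b : Bool) (i p q : ℕ) :
    insertEntry i i (rootSwap b p q) = rootSwap b (skip i p) (skip i q) := by
  cases b
  · exact insertEntry_swap i p q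
  · exact insertEntry_one i

theorem treePerm_apply_of_notMem (b : Bool) {T : PlaneTree} {a j : ℕ}
    (h : j < a ∨ a + T.numNodes < j) : treePerm b T a j = j := by
  induction T generalizing a b with
  | nil => rfl
  | node _ l r ihl ihr =>
    have hl := l.numLeaves_eq_numNodes_succ
    rw [BinaryTree.numNodes] at h
    rw [treePerm, Perm.mul_apply, Perm.mul_apply, ihr _ (by omega), ihl _ (by omega),
      rootSwap_apply_of_ne b (by omega) (by omega)]

theorem le_treePerm_apply (b : Bool) {T : PlaneTree} {a j : ℕ} (h : a ≤ j) :
    a ≤ treePerm b T a j := by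
  by_contra! hlt
  have := (treePerm b T a).injective (treePerm_apply_of_notMem b (T := T) (Or.inl hlt))
  omega

theorem treePerm_apply_le (b : Bool) {T : PlaneTree} {a j : ℕ} (h : j ≤ a + T.numNodes) :
    treePerm b T a j ≤ a + T.numNodes := by
  by_contra! hlt
  have := (treePerm b T a).injective (treePerm_apply_of_notMem b (T := T) (Or.inr hlt))
  omega

theorem treePerm_true_last (T : PlaneTree) (a : ℕ) :
    treePerm true T a (a + T.numNodes) = a + T.numNodes := by
  induction T generalizing a with
  | nil => rfl
  | node _ l r _ ihr =>
    have hl := l.numLeaves_eq_numNodes_succ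
    have hlast : a + (l.numNodes + r.numNodes + 1) = a + l.numLeaves + r.numNodes := by omega
    rw [treePerm, Perm.mul_apply, Perm.mul_apply, BinaryTree.numNodes, hlast, ihr,
      treePerm_apply_of_notMem _ (by omega)]
    rfl

theorem treePerm_succ {i a : ℕ} (b : Bool) (T : PlaneTree) (h : i ≤ a) :
    treePerm b T (a + 1) = insertEntry i i (treePerm b T a) := by
  induction T generalizing a b with
  | nil => exact (insertEntry_one i).symm
  | node _ l r ihl ihr =>
    rw [treePerm, treePerm, add_right_comm a 1, add_right_comm a 1, add_right_comm (a + _) 1,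
      ihl _ h, ihr _ (by omega), ← insertEntry_mul_insertEntry i i,
      ← insertEntry_mul_insertEntry i i, insertEntry_rootSwap, skip_of_le (by omega),
      skip_of_le (by omega)]

theorem insertEntry_treePerm_of_lt {i a : ℕ} (b : Bool) (T : PlaneTree) (h : a + T.numNodes < i) :
    insertEntry i i (treePerm b T a) = treePerm b T a := by
  refine perm_ext_skip i ?_ fun j => ?_
  · rw [insertEntry_self, treePerm_apply_of_notMem b (Or.inr h)]
  · rw [insertEntry_skip]
    rcases le_or_gt j (a + T.numNodes) with hj | hj
    · rw [skip_of_lt (hj.trans_lt h), skip_of_lt ((treePerm_apply_le b hj).trans_lt h)]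
    · have hj' : a + T.numNodes < skip i j := by unfold skip; split_ifs <;> omega
      rw [treePerm_apply_of_notMem b (Or.inr hj), treePerm_apply_of_notMem b (Or.inr hj')]

theorem growPos_congr {i : ℕ} {v w : Perm ℕ} (h : v i < i ↔ w i < i) :
    growPos i v = growPos i w := by
  unfold growPos
  simp only [h]

theorem treePerm_node_left {l r : PlaneTree} {a i : ℕ} (h : IsTerm l a i)
    (ih : treePerm false l a = grow i (treePerm false (trimTree l a i) a)) (b : Bool) :
    treePerm b (.node () l r) a = grow i (treePerm b (.node () (trimTree l a i) r) a) := by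
  have hi := h.mem_Ico
  have hl := l.numLeaves_eq_numNodes_succ
  have hnodes := numNodes_trimTree h
  have hleaves := numLeaves_trimTree h
  set l' := trimTree l a i
  have hpos : growPos i (treePerm b (.node () l' r) a) = growPos i (treePerm false l' a) := by
    refine growPos_congr ?_
    rw [treePerm, Perm.mul_apply, Perm.mul_apply, treePerm_apply_of_notMem true (by omega),
      rootSwap_apply_lt_iff b (by omega) (by omega)]
  have hr : treePerm true r (a + l.numLeaves) =
      insertEntry (growPos i (treePerm false l' a)) (growPos i (treePerm false l' a))
        (treePerm true r (a + l'.numLeaves)) := by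
    have := growPos_eq_or i (treePerm false l' a)
    rw [← treePerm_succ _ _ (by omega), add_assoc, hleaves]
  have hroot : rootSwap b (a + l.numNodes) (a + l.numLeaves + r.numNodes) =
      insertEntry i i (rootSwap b (a + l'.numNodes) (a + l'.numLeaves + r.numNodes)) := by
    rw [insertEntry_rootSwap, skip_of_le (by omega), skip_of_le (by omega), ← hnodes, ← hleaves]
    congr 1
    omega
  rw [grow, hpos, treePerm, treePerm, hroot, ih, hr, grow, insertEntry_mul_insertEntry,
    insertEntry_mul_insertEntry]

theorem treePerm_node_right {l r : PlaneTree} {a i k : ℕ} (h : IsTerm r (a + l.numLeaves) i)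
    (ih : treePerm true r (a + l.numLeaves) =
      insertEntry k i (treePerm true (trimTree r (a + l.numLeaves) i) (a + l.numLeaves)))
    (b : Bool) :
    treePerm b (.node () l r) a =
      insertEntry k i (treePerm b (.node () l (trimTree r (a + l.numLeaves) i)) a) := by
  have hi := h.mem_Ico
  have hl := l.numLeaves_eq_numNodes_succ
  have hnodes := numNodes_trimTree h
  set r' := trimTree r (a + l.numLeaves) i
  have hroot : rootSwap b (a + l.numNodes) (a + l.numLeaves + r.numNodes) =
      insertEntry i i (rootSwap b (a + l.numNodes) (a + l.numLeaves + r'.numNodes)) := by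
    rw [insertEntry_rootSwap, skip_of_lt (by omega), skip_of_le (by omega), ← hnodes, add_assoc,
      add_assoc, add_assoc]
  have hleft : treePerm false l a = insertEntry i i (treePerm false l a) :=
    (insertEntry_treePerm_of_lt false l (by omega)).symm
  rw [treePerm, treePerm, hroot, ih, hleft, insertEntry_mul_insertEntry,
    insertEntry_mul_insertEntry, ← hleft]

theorem treePerm_node_apply {l r : PlaneTree} {a i : ℕ} (hi : a + l.numLeaves ≤ i)
    (hlt : i < a + l.numLeaves + r.numNodes) (b : Bool) :
    treePerm b (.node () l r) a i = treePerm true r (a + l.numLeaves) i := by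
  have hl := l.numLeaves_eq_numNodes_succ
  have hge : a + l.numLeaves ≤ treePerm true r (a + l.numLeaves) i := le_treePerm_apply _ hi
  have hne : treePerm true r (a + l.numLeaves) i ≠ a + l.numLeaves + r.numNodes := fun hc => by
    have := (treePerm true r (a + l.numLeaves)).injective (hc.trans (treePerm_true_last _ _).symm)
    omega
  rw [treePerm, Perm.mul_apply, Perm.mul_apply, treePerm_apply_of_notMem false (by omega),
    rootSwap_apply_of_ne b (by omega) hne]

theorem treePerm_false_node_last (l r : PlaneTree) (a : ℕ) :
    treePerm false (.node () l r) a (a + l.numLeaves + r.numNodes) = a + l.numNodes := by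
  have hl := l.numLeaves_eq_numNodes_succ
  rw [treePerm, Perm.mul_apply, Perm.mul_apply, treePerm_true_last,
    treePerm_apply_of_notMem false (by omega)]
  exact swap_apply_right _ _

/-- If the root is a right child, then so is a terminal node with right leaf `a + T.numNodes`; hence
`LTree.cut` deletes that node, and the inserted entry is a fixed point. -/
theorem treePerm_eq_insertEntry {T : PlaneTree} {a i : ℕ} (h : IsTerm T a i) (b : Bool) :
    treePerm b T a = insertEntry
      (if b = true ∧ i + 1 = a + T.numNodes then i else growPos i (treePerm b (trimTree T a i) a))
      i (treePerm b (trimTree T a i) a) := by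
  induction T generalizing a b with
  | nil => exact h.elim
  | node _ l r ihl ihr =>
    have hl := l.numLeaves_eq_numNodes_succ
    rcases h with ⟨rfl, rfl, rfl⟩ | h | h
    · rw [trimTree_node_nil]
      cases b
      · simp [treePerm, rootSwap, growPos, ← insertEntry_self_mul_swap, insertEntry_one]
      · simp [treePerm, rootSwap, insertEntry_one]
    · have hi := h.mem_Ico
      have hl' := ihl h false
      rw [if_neg (by simp)] at hl'
      rw [trimTree_node_left h, if_neg (by rw [BinaryTree.numNodes]; omega)]
      exact treePerm_node_left h hl' b
    · have hi := h.mem_Ico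
      have hnodes := numNodes_trimTree h
      rw [trimTree_node_right h, treePerm_node_right h (ihr h true) b]
      have hlast : i + 1 = a + (BinaryTree.node () l r).numNodes ↔
          i + 1 = a + l.numLeaves + r.numNodes := by
        rw [BinaryTree.numNodes]
        omega
      simp only [hlast]
      congr 1
      by_cases hi' : i + 1 = a + l.numLeaves + r.numNodes
      · cases b
        · set r' := trimTree r (a + l.numLeaves) i
          have hi_last : i = a + l.numLeaves + r'.numNodes := by omega
          rw [if_pos ⟨trivial, hi'⟩, if_neg (by simp), eq_comm, growPos_eq_self_iff, hi_last,
            treePerm_false_node_last]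
          omega
        · rw [if_pos ⟨trivial, hi'⟩, if_pos ⟨rfl, hi'⟩]
      · rw [if_neg (by simp [hi']), if_neg (by simp [hi'])]
        refine growPos_congr ?_
        rw [treePerm_node_apply hi.1 (by omega)]

end TreePermutations

section Forests

open Equiv

/-! ### Indexed forests as right combs -/

/-- The right comb whose left subtrees are the first `K` trees of a sequence; it has the same
terminal nodes as these trees, except possibly for the bottom node of the comb. -/
def comb : (ℕ → PlaneTree) → ℕ → PlaneTree
  | _, 0 => .nil
  | f, K + 1 => .node () (f 0) (comb (fun k => f (k + 1)) K)

/-- The number of leaves of the first `k` trees of a sequence, which is also the first leaf of the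
next tree. -/
def leafCount (f : ℕ → PlaneTree) (k : ℕ) : ℕ := ∑ j ∈ Finset.range k, (f j).numLeaves

theorem leafCount_zero (f : ℕ → PlaneTree) : leafCount f 0 = 0 := rfl

theorem leafCount_succ (f : ℕ → PlaneTree) (k : ℕ) :
    leafCount f (k + 1) = leafCount f k + (f k).numLeaves := Finset.sum_range_succ _ _

theorem leafCount_succ' (f : ℕ → PlaneTree) (k : ℕ) :
    leafCount f (k + 1) = (f 0).numLeaves + leafCount (fun k => f (k + 1)) k :=
  (Finset.sum_range_succ' _ _).trans (add_comm _ _)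

theorem leafCount_add_le {f : ℕ → PlaneTree} {k m : ℕ} (h : k < m) :
    leafCount f k + (f k).numLeaves ≤ leafCount f m := by
  rw [← leafCount_succ]
  exact Finset.sum_le_sum_of_subset (Finset.range_mono h)

theorem comb_congr {f g : ℕ → PlaneTree} {K : ℕ} (h : ∀ k < K, f k = g k) :
    comb f K = comb g K := by
  induction K generalizing f g with
  | zero => rfl
  | succ K ih => rw [comb, comb, h 0 (by omega), ih fun k hk => h (k + 1) (by omega)]

theorem eq_of_comb_eq {f g : ℕ → PlaneTree} {K : ℕ} (h : comb f K = comb g K) :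
    ∀ k < K, f k = g k := by
  induction K generalizing f g with
  | zero => intro k hk; omega
  | succ K ih =>
    rw [comb, comb] at h
    injection h with _ hleft hright
    rintro (_ | k) hk
    · exact hleft
    · exact ih hright k (by omega)

theorem numNodes_comb (f : ℕ → PlaneTree) (K : ℕ) : (comb f K).numNodes = leafCount f K := by
  induction K generalizing f with
  | zero => rfl
  | succ K ih =>
    rw [comb, BinaryTree.numNodes, ih, leafCount_succ', BinaryTree.numLeaves_eq_numNodes_succ]
    omega

theorem isTerm_comb {f : ℕ → PlaneTree} {K a i : ℕ} : IsTerm (comb f K) a i ↔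
    (∃ k < K, IsTerm (f k) (a + leafCount f k) i) ∨
      ∃ k, K = k + 1 ∧ f k = .nil ∧ i = a + leafCount f k := by
  induction K generalizing f a with
  | zero => simp [comb, IsTerm]
  | succ K ih =>
    rw [comb, IsTerm, ih]
    constructor
    · rintro (⟨hleft, hright, hi⟩ | h | ⟨k, hk, h⟩ | ⟨k, rfl, htree, hi⟩)
      · cases K with
        | zero => exact Or.inr ⟨0, rfl, hleft, hi⟩
        | succ K => rw [comb] at hright; cases hright
      · exact Or.inl ⟨0, by omega, h⟩
      · exact Or.inl ⟨k + 1, by omega, by rwa [leafCount_succ', ← add_assoc]⟩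
      · exact Or.inr ⟨k + 1, rfl, htree, by rw [leafCount_succ']; omega⟩
    · rintro (⟨_ | k, hk, h⟩ | ⟨k, hk, htree, hi⟩)
      · exact Or.inr (Or.inl h)
      · rw [leafCount_succ', ← add_assoc] at h
        exact Or.inr (Or.inr (Or.inl ⟨k, by omega, h⟩))
      · obtain rfl : K = k := by omega
        cases K with
        | zero => exact Or.inl ⟨htree, rfl, hi⟩
        | succ K =>
          rw [leafCount_succ', ← add_assoc] at hi
          exact Or.inr (Or.inr (Or.inr ⟨K, rfl, htree, hi⟩))

theorem trimTree_comb {f : ℕ → PlaneTree} {K a i k : ℕ} (hk : k < K)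
    (h : IsTerm (f k) (a + leafCount f k) i) :
    trimTree (comb f K) a i = comb (fun k => trimTree (f k) (a + leafCount f k) i) K := by
  induction K generalizing f a k with
  | zero => omega
  | succ K ih =>
    have hleaves := (f 0).numLeaves_eq_numNodes_succ
    rw [comb, comb]
    cases k with
    | zero =>
      rw [leafCount_zero, add_zero] at h ⊢
      rw [trimTree_node_left h]
      congr 1
      refine comb_congr fun k _ => (trimTree_of_not_isTerm fun h' => ?_).symm
      have := h'.mem_Ico
      have := h.mem_Ico
      have := leafCount_succ' f k
      omega
    | succ k =>
      rw [leafCount_succ', ← add_assoc] at h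
      rw [trimTree_node_right (isTerm_comb.mpr (Or.inl ⟨k, by omega, h⟩)),
        ih (f := fun k => f (k + 1)) (by omega : k < K) h, leafCount_zero, add_zero]
      congr 1
      · refine (trimTree_of_not_isTerm fun h' => ?_).symm
        have := h'.mem_Ico
        have := h.mem_Ico
        omega
      · refine comb_congr fun k _ => ?_
        simp only [leafCount_succ', ← add_assoc]

theorem treePerm_comb_succ {f : ℕ → PlaneTree} {K : ℕ} (h : f K = .nil) (a : ℕ) :
    treePerm true (comb f (K + 1)) a = treePerm true (comb f K) a := by
  induction K generalizing f a with
  | zero => simp [comb, h, treePerm, rootSwap]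
  | succ K ih =>
    exact congrArg (fun σ : Perm ℕ => 1 * (treePerm false (f 0) a * σ))
      (ih (f := fun k => f (k + 1)) h _)

namespace IndexedForest

/-- All trees of the forest from the `K`-th on are trivial. -/
def TrivialFrom (F : IndexedForest) (K : ℕ) : Prop := ∀ k, K ≤ k → F.tree k = .nil

theorem exists_trivialFrom (F : IndexedForest) : ∃ K, F.TrivialFrom K := by
  obtain ⟨K, hK⟩ := F.finite.bddAbove
  exact ⟨K + 1, fun k hk => by_contra fun h => absurd (hK h) (by omega)⟩

variable {F : IndexedForest} {K M i k : ℕ}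

theorem TrivialFrom.mono (h : F.TrivialFrom K) (hM : K ≤ M) : F.TrivialFrom M :=
  fun k hk => h k (hM.trans hk)

theorem TrivialFrom.trim (h : F.TrivialFrom K) (i : ℕ) : (F.trim i).TrivialFrom K := fun k hk => by
  change trimTree (F.tree k) (F.start k) i = .nil
  rw [h k hk, trimTree_nil]

theorem TrivialFrom.lt_of_isTerm {a : ℕ} (h : F.TrivialFrom K) (hk : IsTerm (F.tree k) a i) :
    k < K := by
  by_contra hc
  exact hk.ne_nil (h k (by omega))

theorem exists_internal_iff (T : PlaneTree) (a i : ℕ) :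
    (∃ v ∈ (label T a).internal, v.IsTerminal ∧ v.flag = i) ↔ IsTerm T a i := by
  induction T generalizing a with
  | nil => simp [label, LTree.internal, IsTerm]
  | node _ l r hl hr =>
    have hroot : (LTree.IsTerminal (.node (label l a) (label r (a + l.numLeaves))) ∧
        (LTree.node (label l a) (label r (a + l.numLeaves))).flag = i) ↔
        (l = .nil ∧ r = .nil ∧ i = a) := by
      cases l <;> cases r <;> simp [label, LTree.IsTerminal, LTree.flag, eq_comm]
    rw [IsTerm, ← hl, ← hr, ← hroot]
    simp only [label, LTree.internal, List.mem_cons, List.mem_append, or_and_right, exists_or,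
      exists_eq_left]

theorem mem_qdes_iff_exists : i ∈ F.qdes ↔ ∃ k, IsTerm (F.tree k) (leafCount F.tree k) i := by
  simp only [qdes, Set.mem_ofPred_eq, labelled, exists_internal_iff]
  rfl

theorem mem_qdes_iff (h : F.TrivialFrom K) :
    i ∈ F.qdes ↔ IsTerm (comb F.tree (K + 1)) 0 i ∧ i < leafCount F.tree K := by
  rw [mem_qdes_iff_exists, isTerm_comb]
  simp only [zero_add]
  constructor
  · rintro ⟨k, hk⟩
    have hkK := h.lt_of_isTerm hk
    refine ⟨Or.inl ⟨k, by omega, hk⟩, ?_⟩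
    have := hk.mem_Ico
    have := leafCount_add_le (f := F.tree) hkK
    have := (F.tree k).numLeaves_eq_numNodes_succ
    omega
  · rintro ⟨⟨k, -, hk⟩ | ⟨k, hk, -, rfl⟩, hlt⟩
    · exact ⟨k, hk⟩
    · obtain rfl : K = k := by omega
      omega

theorem comb_trim (h : F.TrivialFrom K) (hi : i ∈ F.qdes) :
    comb (F.trim i).tree (K + 1) = trimTree (comb F.tree (K + 1)) 0 i := by
  obtain ⟨k, hk⟩ := mem_qdes_iff_exists.mp hi
  have hkK := h.lt_of_isTerm hk
  rw [trimTree_comb (k := k) (by omega) (by rwa [zero_add])]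
  simp only [zero_add]
  rfl

theorem leafCount_trim (h : F.TrivialFrom K) (hi : i ∈ F.qdes) :
    leafCount (F.trim i).tree K + 1 = leafCount F.tree K := by
  have hnodes := numNodes_trimTree ((mem_qdes_iff h).mp hi).1
  rw [← comb_trim h hi, numNodes_comb, numNodes_comb, leafCount_succ, leafCount_succ,
    h K le_rfl, h.trim i K le_rfl] at hnodes
  omega

theorem mem_qdes_trim_iff (hk : k ∈ F.qdes) (hik : i ≠ k) (hik' : i + 1 ≠ k) :
    i ∈ (F.trim k).qdes ↔ skip k i ∈ F.qdes := by
  obtain ⟨K, h⟩ := F.exists_trivialFrom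
  have hcount := leafCount_trim h hk
  have hk' := (mem_qdes_iff h).mp hk
  rw [mem_qdes_iff (h.trim k), mem_qdes_iff h, comb_trim h hk,
    isTerm_trimTree_iff hk'.1 hik hik', and_congr_right_iff]
  intro _
  rcases lt_or_ge i k with hlt | hge
  · rw [skip_of_lt hlt]
    omega
  · rw [skip_of_le hge]
    omega

theorem trim_comm (hk : k ∈ F.qdes) (hi : i + 1 ∈ F.qdes) (hki : k < i) :
    (F.trim k).trim i = (F.trim (i + 1)).trim k := by
  obtain ⟨K, h⟩ := F.exists_trivialFrom
  have hi' : i ∈ (F.trim k).qdes := by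
    rwa [mem_qdes_trim_iff hk (by omega) (by omega), skip_of_le hki.le]
  have hk' : k ∈ (F.trim (i + 1)).qdes := by
    rwa [mem_qdes_trim_iff hi (by omega) (by omega), skip_of_lt (by omega)]
  have hcomb : comb ((F.trim k).trim i).tree (K + 1) =
      comb ((F.trim (i + 1)).trim k).tree (K + 1) := by
    rw [comb_trim (h.trim k) hi', comb_trim h hk, comb_trim (h.trim (i + 1)) hk', comb_trim h hi,
      trimTree_comm ((mem_qdes_iff h).mp hk).1 ((mem_qdes_iff h).mp hi).1 hki]
  refine IndexedForest.ext (funext fun m => ?_)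
  by_cases hm : m < K + 1
  · exact eq_of_comb_eq hcomb m hm
  · rw [(h.trim k).trim i m (by omega), (h.trim (i + 1)).trim k m (by omega)]

theorem exists_mem_qdes (h : F ≠ empty) : ∃ i, i ∈ F.qdes := by
  obtain ⟨k, hk⟩ : ∃ k, F.tree k ≠ .nil := by
    by_contra! hc
    exact h (IndexedForest.ext (funext hc))
  obtain ⟨i, hi⟩ := exists_isTerm hk (leafCount F.tree k)
  exact ⟨i, mem_qdes_iff_exists.mpr ⟨k, hi⟩⟩

theorem notMem_qdes_empty (i : ℕ) : i ∉ empty.qdes := fun h => by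
  obtain ⟨_, hk⟩ := mem_qdes_iff_exists.mp h
  exact hk

theorem exists_forall_notMem_qdes (F : IndexedForest) : ∃ N, ∀ i, N ≤ i → i ∉ F.qdes := by
  obtain ⟨K, h⟩ := F.exists_trivialFrom
  exact ⟨leafCount F.tree K, fun i hi hq => absurd ((mem_qdes_iff h).mp hq).2 (by omega)⟩

/-- The number of internal nodes of the forest. -/
noncomputable def size (F : IndexedForest) : ℕ := ∑ᶠ k, (F.tree k).numNodes

theorem TrivialFrom.size_add (h : F.TrivialFrom K) : F.size + K = leafCount F.tree K := by
  have hsize : F.size = ∑ k ∈ Finset.range K, (F.tree k).numNodes := by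
    refine finsum_eq_sum_of_support_subset _ fun k hk => ?_
    rw [Finset.mem_coe, Finset.mem_range]
    by_contra hc
    exact hk (congrArg BinaryTree.numNodes (h k (by omega)))
  simp_rw [hsize, leafCount, BinaryTree.numLeaves_eq_numNodes_succ, Finset.sum_add_distrib,
    Finset.sum_const, Finset.card_range, smul_eq_mul, mul_one]

theorem size_trim (hi : i ∈ F.qdes) : (F.trim i).size + 1 = F.size := by
  obtain ⟨K, h⟩ := F.exists_trivialFrom
  have := leafCount_trim h hi
  have := h.size_add
  have := (h.trim i).size_add
  omega

theorem trim_induction {motive : IndexedForest → Prop}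
    (ih : ∀ F : IndexedForest, (∀ i ∈ F.qdes, motive (F.trim i)) → motive F)
    (F : IndexedForest) : motive F := by
  induction hd : F.size generalizing F with
  | zero => exact ih F fun i hi => absurd (size_trim hi) (by omega)
  | succ d ihd => exact ih F fun i hi => ihd _ (by have := size_trim hi; omega)

/-- The noncrossing permutation of a forest. It is defined through a comb of arbitrary sufficient
length, so that it refers to no `n`; `forToNC_eq_perm` identifies it with `ForToNC n F`. -/
noncomputable def perm (F : IndexedForest) : Perm ℕ :=
  treePerm true (comb F.tree F.exists_trivialFrom.choose) 0

theorem TrivialFrom.treePerm_comb_of_le (h : F.TrivialFrom K) (hM : K ≤ M) :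
    treePerm true (comb F.tree M) 0 = treePerm true (comb F.tree K) 0 := by
  induction M, hM using Nat.le_induction with
  | base => rfl
  | succ M hM ih => rw [treePerm_comb_succ (h M hM), ih]

theorem TrivialFrom.treePerm_comb (h : F.TrivialFrom K) :
    treePerm true (comb F.tree K) 0 = F.perm := by
  have hchoose := F.exists_trivialFrom.choose_spec
  rw [perm, ← h.treePerm_comb_of_le (le_max_left K F.exists_trivialFrom.choose),
    hchoose.treePerm_comb_of_le (le_max_right _ _)]

theorem perm_empty : empty.perm = 1 :=
  (TrivialFrom.treePerm_comb (F := empty) (K := 0) fun _ _ => rfl).symm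

theorem perm_eq_grow (hi : i ∈ F.qdes) : F.perm = grow i (F.trim i).perm := by
  obtain ⟨K, h⟩ := F.exists_trivialFrom
  obtain ⟨hterm, hlt⟩ := (mem_qdes_iff h).mp hi
  rw [← (h.mono K.le_succ).treePerm_comb, ← ((h.trim i).mono K.le_succ).treePerm_comb,
    comb_trim h hi, treePerm_eq_insertEntry hterm true, if_neg, grow]
  rw [numNodes_comb, leafCount_succ, h K le_rfl, BinaryTree.numLeaves]
  omega

theorem isNC_perm (F : IndexedForest) : IsNC F.perm := by
  induction F using trim_induction with
  | ih F ih =>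
    by_cases h : F = empty
    · rw [h, perm_empty]
      exact isNC_one
    · obtain ⟨i, hi⟩ := exists_mem_qdes h
      rw [perm_eq_grow hi]
      exact isNC_grow_iff.mpr (ih i hi)

end IndexedForest

end Forests

section DoubleForestFamily

/-! ### Existence and uniqueness of the double forest polynomials -/

open IndexedForest

open Classical in
/-- The recursive construction of the double forest polynomials. -/
noncomputable def forestPoly (F : IndexedForest) : PolyTX :=
  if F = empty then 1 else
    solve (fun i => if _h : i ∈ F.qdes then omitT i (forestPoly (F.trim i)) else 0)
      F.exists_forall_notMem_qdes.choose F.exists_forall_notMem_qdes.choose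
termination_by F.size
decreasing_by
  have := size_trim _h
  omega

open Classical in
/-- The prescribed image of the polynomial of `F` under `E_i`. -/
noncomputable def trimmedPoly (P : IndexedForest → PolyTX) (F : IndexedForest) (i : ℕ) : PolyTX :=
  if i ∈ F.qdes then omitT i (P (F.trim i)) else 0

variable {P Q : IndexedForest → PolyTX} {F : IndexedForest} {i k : ℕ}

theorem trimmedPoly_of_mem (P : IndexedForest → PolyTX) (h : i ∈ F.qdes) :
    trimmedPoly P F i = omitT i (P (F.trim i)) := if_pos h

theorem trimmedPoly_of_notMem (P : IndexedForest → PolyTX) (h : i ∉ F.qdes) :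
    trimmedPoly P F i = 0 := if_neg h

theorem forestPoly_empty : forestPoly empty = 1 := by
  rw [forestPoly, if_pos rfl]

theorem forestPoly_of_ne (h : F ≠ empty) :
    forestPoly F = solve (trimmedPoly forestPoly F) F.exists_forall_notMem_qdes.choose
      F.exists_forall_notMem_qdes.choose := by
  rw [forestPoly, if_neg h]
  congr 1

theorem trimDiff_trimmedPoly
    (hP : ∀ i ∈ F.qdes, ∀ j, eope j (P (F.trim i)) = trimmedPoly P (F.trim i) j) (hki : k < i) :
    trimDiff i (i + 1) (trimmedPoly P F k) =
      (x i - t (i + 1)) * eope k (trimmedPoly P F (i + 1)) := by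
  by_cases hk : k ∈ F.qdes <;> by_cases hi : i + 1 ∈ F.qdes
  · have hik : i ∈ (F.trim k).qdes := by
      rwa [mem_qdes_trim_iff hk (by omega) (by omega), skip_of_le hki.le]
    have hki' : k ∈ (F.trim (i + 1)).qdes := by
      rwa [mem_qdes_trim_iff hi (by omega) (by omega), skip_of_lt (by omega)]
    rw [trimmedPoly_of_mem P hk, trimmedPoly_of_mem P hi, trimDiff_succ_omitT hki.le, hP k hk,
      eope_omitT (by omega), hP _ hi, trimmedPoly_of_mem P hik, trimmedPoly_of_mem P hki',
      omitT_comm hki.le, trim_comm hk hi hki]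
  · have hik : i ∉ (F.trim k).qdes := by
      rwa [mem_qdes_trim_iff hk (by omega) (by omega), skip_of_le hki.le]
    rw [trimmedPoly_of_mem P hk, trimmedPoly_of_notMem P hi, trimDiff_succ_omitT hki.le, hP k hk,
      trimmedPoly_of_notMem P hik, map_zero, eope_zero]
  · have hki' : k ∉ (F.trim (i + 1)).qdes := by
      rwa [mem_qdes_trim_iff hi (by omega) (by omega), skip_of_lt (by omega)]
    rw [trimmedPoly_of_notMem P hk, trimmedPoly_of_mem P hi, eope_omitT (by omega), hP _ hi,
      trimmedPoly_of_notMem P hki']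
    simp [trimDiff]
  · rw [trimmedPoly_of_notMem P hk, trimmedPoly_of_notMem P hi, eope_zero]
    simp [trimDiff]

theorem isHomogeneous_forestPoly (F : IndexedForest) :
    (forestPoly F).IsHomogeneous F.size := by
  induction F using trim_induction with
  | ih F ih =>
    by_cases hF : F = empty
    · have hsize : F.size = 0 := by simp [hF, size, empty]
      rw [hsize, hF, forestPoly_empty]
      exact MvPolynomial.isHomogeneous_one _ _
    · obtain ⟨i₀, hi₀⟩ := exists_mem_qdes hF
      rw [forestPoly_of_ne hF, ← size_trim hi₀]
      refine isHomogeneous_solve (fun i => ?_) _ _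
      by_cases hi : i ∈ F.qdes
      · have hsize : (F.trim i).size = (F.trim i₀).size := by
          have := size_trim hi
          have := size_trim hi₀
          omega
        rw [trimmedPoly_of_mem _ hi, ← hsize]
        exact isHomogeneous_omitT (ih i hi) i
      · rw [trimmedPoly_of_notMem _ hi]
        exact MvPolynomial.isHomogeneous_zero _ _ _

theorem eope_forestPoly (F : IndexedForest) (i : ℕ) :
    eope i (forestPoly F) = trimmedPoly forestPoly F i := by
  induction F using trim_induction generalizing i with
  | ih F ih =>
    by_cases hF : F = empty
    · rw [hF, forestPoly_empty, eope_of_mem_xBelow (one_mem _),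
        trimmedPoly_of_notMem _ (notMem_qdes_empty i)]
    · rw [forestPoly_of_ne hF]
      exact eope_solve
        (fun i hi => trimmedPoly_of_notMem _ (F.exists_forall_notMem_qdes.choose_spec i hi))
        (fun _ _ hki => trimDiff_trimmedPoly ih hki) le_rfl i (by omega)

theorem isDoubleForestFamily_forestPoly : IsDoubleForestFamily forestPoly where
  homogeneous F := ⟨_, isHomogeneous_forestPoly F⟩
  ev_one_empty := by rw [forestPoly_empty, map_one]
  ev_one F hF := by rw [forestPoly_of_ne hF, ev_one_solve]
  eope_mem F i hi := by rw [eope_forestPoly, trimmedPoly_of_mem _ hi]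
  eope_notMem F i hi := by rw [eope_forestPoly, trimmedPoly_of_notMem _ hi]

theorem IsDoubleForestFamily.unique (hP : IsDoubleForestFamily P)
    (hQ : IsDoubleForestFamily Q) : P = Q := by
  funext F
  induction F using trim_induction with
  | ih F ih =>
    refine sub_eq_zero.mp (eq_zero_of_eope_eq_zero (fun i => ?_) ?_)
    · rw [eope_sub]
      by_cases hi : i ∈ F.qdes
      · rw [hP.eope_mem F i hi, hQ.eope_mem F i hi, ih i hi, sub_self]
      · rw [hP.eope_notMem F i hi, hQ.eope_notMem F i hi, sub_self]
    · rw [map_sub]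
      by_cases hF : F = empty
      · rw [hF, hP.ev_one_empty, hQ.ev_one_empty, sub_self]
      · rw [hP.ev_one F hF, hQ.ev_one F hF, sub_self]

theorem isDoubleForestFamily_doubleForest : IsDoubleForestFamily doubleForest := by
  have h : ∃! P : IndexedForest → PolyTX, IsDoubleForestFamily P :=
    ⟨forestPoly, isDoubleForestFamily_forestPoly, fun _ hQ =>
      hQ.unique isDoubleForestFamily_forestPoly⟩
  rw [doubleForest, dif_pos h]
  exact h.choose_spec.1

end DoubleForestFamily

section Evaluations

open Equiv MvPolynomial

/-! ### Evaluations at noncrossing permutations -/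

/-- The evaluation `x_j ↦ t_{w(j)}` for the variables `t` without `t_i`. -/
noncomputable def evSkip (i : ℕ) (w : Perm ℕ) : PolyTX →ₐ[ℤ] PolyT :=
  aeval (Sum.elim (fun j => X (skip i (w j))) X)

theorem evSkip_x (i : ℕ) (w : Perm ℕ) (j : ℕ) : evSkip i w (x j) = X (skip i (w j)) := by
  simp [evSkip, x]

theorem evSkip_t (i : ℕ) (w : Perm ℕ) (j : ℕ) : evSkip i w (t j) = X j := by
  simp [evSkip, t]

theorem ev_insertEntry (k i : ℕ) (w : Perm ℕ) (f : PolyTX) :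
    ev (insertEntry k i w) f = evSkip i w (insertT k i f) := by
  suffices h : ev (insertEntry k i w) = (evSkip i w).comp (insertT k i) by
    rw [h, AlgHom.comp_apply]
  refine polyTX_hom_ext (fun j => ?_) (fun j => by simp [ev_t, evSkip_t])
  rw [AlgHom.comp_apply, ev_x, insertT_x]
  rcases eq_or_exists_eq_skip k j with rfl | ⟨j, rfl⟩
  · simp [evSkip_t]
  · rw [insertEntry_skip]
    rcases lt_or_ge j k with hj | hj
    · rw [skip_of_lt hj, if_pos hj, evSkip_x]
    · rw [skip_of_le hj, if_neg (by omega), if_neg (by omega), evSkip_x, Nat.add_sub_cancel]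

theorem evSkip_omitT (i : ℕ) (w : Perm ℕ) (f : PolyTX) :
    evSkip i w (omitT i f) = rename (skip i) (ev w f) := by
  suffices h : (evSkip i w).comp (omitT i) = (rename (skip i)).comp (ev w) by
    rw [← AlgHom.comp_apply, h, AlgHom.comp_apply]
  exact polyTX_hom_ext (fun j => by simp [omitT_x, evSkip_x, ev_x])
    (fun j => by simp [omitT_t, evSkip_t, ev_t])

theorem ev_insertEntry_succ (i : ℕ) (w : Perm ℕ) (f : PolyTX) :
    ev (insertEntry (i + 1) i w) f =
      ev (insertEntry i i w) f + (X (skip i (w i)) - X i) * evSkip i w (eope i f) := by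
  rw [ev_insertEntry, ev_insertEntry, ← sub_eq_iff_eq_add', ← map_sub]
  change evSkip i w (trimDiff i i f) = _
  rw [trimDiff_self, map_mul, map_sub, evSkip_x, evSkip_t]

theorem ev_grow (i : ℕ) (w : Perm ℕ) (f : PolyTX) :
    ev (grow i w) f = ev (grow i w * swap i (i + 1)) f +
      (X (grow i w i) - X (grow i w (i + 1))) * evSkip i w (eope i f) := by
  rcases growPos_eq_or i w with h | h
  · have hsucc : insertEntry i i w (i + 1) = skip i (w i) := by
      rw [← skip_of_le le_rfl, insertEntry_skip]
    rw [grow, h, insertEntry_self_mul_swap, ev_insertEntry_succ, hsucc, insertEntry_self]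
    ring
  · have hself : insertEntry (i + 1) i w i = skip i (w i) := by
      rw [← insertEntry_skip (i + 1), skip_of_lt i.lt_succ_self]
    rw [grow, h, ← insertEntry_self_mul_swap, mul_swap_mul_self, insertEntry_self_mul_swap,
      ev_insertEntry_succ, hself, insertEntry_self]

variable {n i : ℕ} {σ w : Perm ℕ}

theorem lt_of_descent (hn : ∀ a, n ≤ a → σ a = a) (hd : σ (i + 1) < σ i) : i + 1 < n := by
  by_contra! hc
  rw [hn _ hc] at hd
  rcases lt_or_ge i n with hi | hi
  · have := apply_lt_of_fixed hn hi
    omega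
  · rw [hn i hi] at hd
    omega

theorem apply_eq_self_of_grow (hn : ∀ a, n ≤ a → grow i w a = a) :
    ∀ a, n ≤ a → w a = a := by
  have hin := lt_of_descent hn (grow_descent i w)
  obtain ⟨m, rfl⟩ : ∃ m, n = m + 1 := ⟨n - 1, by omega⟩
  have hpos : growPos i w ≤ m := by
    have := growPos_eq_or i w
    omega
  exact fun a ha => (insertEntry_apply_of_le hpos (by omega)).mp hn a (by omega)

theorem sum_rk_mul_swap_lt (hn : ∀ a, n ≤ a → grow i w a = a) :
    ∑ z ∈ Finset.range n ×ˢ Finset.range n, rk (grow i w * swap i (i + 1)) z.1 z.2 <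
      ∑ z ∈ Finset.range n ×ˢ Finset.range n, rk (grow i w) z.1 z.2 := by
  have hin := lt_of_descent hn (grow_descent i w)
  refine Finset.sum_lt_sum (fun z _ => bruhatLE_grow_mul_swap i w z.1 z.2)
    ⟨(i + 1, grow i w i), ?_, rk_mul_swap_lt (grow_descent i w)⟩
  simpa [hin] using apply_lt_of_fixed hn (by omega)

theorem invNC_grow (hw : IsNC w) (hn : ∀ a, n ≤ a → grow i w a = a) :
    invNC n (grow i w) = insert (i, i + 1)
      ((invNC n w).image (Prod.map (skip (growPos i w)) (skip (growPos i w)))) := by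
  ext ⟨a, b⟩
  rw [mem_invNC_iff hn, isInv_grow_iff hw]
  simp only [Finset.mem_insert, Prod.mk.injEq, Finset.mem_image,
    mem_invNC_iff (apply_eq_self_of_grow hn), Prod.exists, Prod.map_apply]
  refine or_congr Iff.rfl ⟨?_, ?_⟩
  · rintro ⟨c, d, rfl, rfl, h⟩
    exact ⟨c, d, h, rfl, rfl⟩
  · rintro ⟨c, d, h, rfl, rfl⟩
    exact ⟨c, d, rfl, rfl, h⟩

theorem prod_invNC_grow (hw : IsNC w) (hn : ∀ a, n ≤ a → grow i w a = a) :
    ∏ p ∈ invNC n (grow i w), (X (grow i w p.1) - X (grow i w p.2) : PolyT) =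
      (X (grow i w i) - X (grow i w (i + 1))) *
        rename (skip i) (∏ p ∈ invNC n w, (X (w p.1) - X (w p.2) : PolyT)) := by
  have hinj := (skip_strictMono (growPos i w)).injective
  rw [invNC_grow hw hn, Finset.prod_insert, Finset.prod_image (hinj.prodMap hinj).injOn, map_prod]
  · refine congrArg _ (Finset.prod_congr rfl fun p _ => ?_)
    simp [grow]
  · simp only [Finset.mem_image, Prod.exists, Prod.map_apply, Prod.mk.injEq, not_exists, not_and]
    intro c d _ hc hd
    rcases growPos_eq_or i w with h | h
    · exact skip_ne _ _ (hc.trans h.symm)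
    · exact skip_ne _ _ (hd.trans h.symm)

namespace IsDoubleForestFamily

open IndexedForest

variable {P : IndexedForest → PolyTX} {F : IndexedForest}

theorem bruhatLE_of_ev_ne_zero (hP : IsDoubleForestFamily P) (hσ : IsNC σ)
    (hn : ∀ a, n ≤ a → σ a = a) (h : ev σ (P F) ≠ 0) : BruhatLE F.perm σ := by
  induction F using trim_induction generalizing σ with
  | ih F ihF =>
    induction hsum : ∑ z ∈ Finset.range n ×ˢ Finset.range n, rk σ z.1 z.2
      using Nat.strong_induction_on generalizing σ with
    | _ _ ihσ =>
      subst hsum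
      by_cases hone : σ = 1
      · have hF : F = empty := by
          by_contra hF
          exact h (by rw [hone, hP.ev_one F hF])
        rw [hone, hF, perm_empty]
        exact fun _ _ => le_rfl
      obtain ⟨i, w, hw, rfl⟩ := hσ.exists_eq_grow hone
      by_cases hswap : ev (grow i w * swap i (i + 1)) (P F) = 0
      · rw [ev_grow, hswap, zero_add] at h
        have hi : i ∈ F.qdes := by
          by_contra hi
          exact h (by rw [hP.eope_notMem F i hi, map_zero, mul_zero])
        rw [hP.eope_mem F i hi, evSkip_omitT] at h
        have hev : ev w (P (F.trim i)) ≠ 0 := fun h0 => h (by rw [h0, map_zero, mul_zero])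
        rw [perm_eq_grow hi]
        exact (ihF i hi hw (apply_eq_self_of_grow hn) hev).insertEntry_grow (growPos_eq_or i _)
      · have hin := lt_of_descent hn (grow_descent i w)
        have hfixed : ∀ a, n ≤ a → (grow i w * swap i (i + 1)) a = a := fun a ha => by
          rw [Perm.mul_apply, swap_apply_of_ne_of_ne (by omega) (by omega), hn a ha]
        have hle := ihσ _ (sum_rk_mul_swap_lt hn) (isNC_grow_mul_swap_iff.mpr hw) hfixed hswap rfl
        exact fun p q => (hle p q).trans (bruhatLE_grow_mul_swap i w p q)

theorem ev_perm_mul_swap (hP : IsDoubleForestFamily P) (hn : ∀ a, n ≤ a → F.perm a = a)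
    (hi : i ∈ F.qdes) : ev (F.perm * swap i (i + 1)) (P F) = 0 := by
  have hd : F.perm (i + 1) < F.perm i := perm_eq_grow hi ▸ grow_descent i _
  have hin := lt_of_descent hn hd
  have hNC : IsNC (F.perm * swap i (i + 1)) := by
    rw [perm_eq_grow hi]
    exact isNC_grow_mul_swap_iff.mpr (F.trim i).isNC_perm
  by_contra h
  refine (rk_mul_swap_lt hd).not_ge (hP.bruhatLE_of_ev_ne_zero (n := n) hNC (fun a ha => ?_) h _ _)
  rw [Perm.mul_apply, swap_apply_of_ne_of_ne (by omega) (by omega), hn a ha]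

theorem ev_perm (hP : IsDoubleForestFamily P) (hn : ∀ a, n ≤ a → F.perm a = a) :
    ev F.perm (P F) = ∏ p ∈ invNC n F.perm, (X (F.perm p.1) - X (F.perm p.2) : PolyT) := by
  induction F using trim_induction with
  | ih F ih =>
    by_cases hF : F = empty
    · have hinv : invNC n 1 = ∅ := Finset.eq_empty_of_forall_notMem fun p hp => by
        obtain ⟨hlt, -, hgt⟩ := (mem_invNC_iff fun _ _ => rfl).mp hp
        exact hlt.asymm hgt
      rw [hF, perm_empty, hP.ev_one_empty, hinv, Finset.prod_empty]
    · obtain ⟨i, hi⟩ := exists_mem_qdes hF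
      have hgrow := perm_eq_grow hi
      have hswap := hP.ev_perm_mul_swap hn hi
      rw [hgrow] at hn hswap ⊢
      rw [ev_grow, hswap, zero_add, hP.eope_mem F i hi, evSkip_omitT,
        ih i hi (apply_eq_self_of_grow hn), prod_invNC_grow (F.trim i).isNC_perm hn]

end IsDoubleForestFamily

end Evaluations

section CutTrees

open Equiv

/-! ### Comparison with `ForToNC` -/

/-- The trees into which `LTree.cut` splits a tree with leaves `a, a + 1, …`, the one at the place
of the root coming first. -/
def pieces (b : Bool) (T : PlaneTree) (a : ℕ) : List LTree :=
  ((label T a).cut b).1 :: ((label T a).cut b).2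

/-- The backward cycle of the set of leaves of a tree. -/
noncomputable def leafCycle (S : LTree) : Perm ℕ := backCycle S.leaves.toFinset

theorem leafCycle_leaf (a : ℕ) : leafCycle (.leaf a) = 1 := by
  simp [leafCycle, LTree.leaves, backCycle]

theorem pieces_nil (b : Bool) (a : ℕ) : pieces b .nil a = [.leaf a] := by
  cases b <;> rfl

theorem cut_true_label (T : PlaneTree) (a : ℕ) :
    ((label T a).cut true).1 = .leaf (a + T.numNodes) := by
  induction T generalizing a with
  | nil => rfl
  | node _ l r _ ihr =>
    have := l.numLeaves_eq_numNodes_succ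
    rw [label, LTree.cut, ihr, BinaryTree.numNodes]
    congr 1
    omega

theorem leaves_label (T : PlaneTree) (a : ℕ) : (label T a).leaves = List.range' a T.numLeaves := by
  induction T generalizing a with
  | nil => rfl
  | node _ l r ihl ihr =>
    rw [label, LTree.leaves, ihl, ihr, BinaryTree.numLeaves, List.range'_append_1]

theorem perm_leaves_cut (b : Bool) (T : LTree) :
    ((T.cut b).1.leaves ++ ((T.cut b).2.map LTree.leaves).flatten).Perm T.leaves := by
  induction T generalizing b with
  | leaf i => cases b <;> simp [LTree.cut, LTree.leaves]
  | node l r ihl ihr =>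
    have ih := (ihl false).append (ihr true)
    cases b <;> simp only [LTree.cut, LTree.leaves, List.map_append, List.flatten_append,
      List.map_cons, List.flatten_cons, List.append_assoc] at ih ⊢
    · exact (List.Perm.append_left _ (List.perm_append_comm_assoc _ _ _)).trans ih
    · exact (List.perm_append_comm_assoc _ _ _).trans
        ((List.Perm.append_left _ (List.perm_append_comm_assoc _ _ _)).trans ih)

theorem perm_leaves_pieces (b : Bool) (T : PlaneTree) (a : ℕ) :
    ((pieces b T a).map LTree.leaves).flatten.Perm (List.range' a T.numLeaves) := by
  rw [← leaves_label]
  exact perm_leaves_cut b _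

theorem pairwise_disjoint_pieces (b : Bool) (T : PlaneTree) (a : ℕ) :
    ((pieces b T a).map fun S => S.leaves.toFinset).Pairwise Disjoint := by
  have hnodup : ((pieces b T a).map LTree.leaves).flatten.Nodup :=
    (perm_leaves_pieces b T a).nodup_iff.mpr List.nodup_range'
  have hdisj := (List.nodup_flatten.mp hnodup).2
  rw [List.pairwise_map] at hdisj ⊢
  exact hdisj.imp List.disjoint_toFinset_iff_disjoint.mpr

theorem exists_mem_pieces_iff (b : Bool) (T : PlaneTree) (a c : ℕ) :
    (∃ S ∈ pieces b T a, c ∈ S.leaves) ↔ a ≤ c ∧ c < a + T.numLeaves := by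
  rw [← List.mem_range'_1, ← (perm_leaves_pieces b T a).mem_iff]
  simp

theorem last_mem_cut_false (T : PlaneTree) (a : ℕ) :
    a + T.numNodes ∈ ((label T a).cut false).1.leaves := by
  cases T with
  | nil => exact List.mem_singleton_self a
  | node _ l r =>
    have := l.numLeaves_eq_numNodes_succ
    rw [label, LTree.cut, LTree.leaves, cut_true_label, BinaryTree.numNodes]
    exact List.mem_append_right _ (List.mem_singleton.mpr (by omega))

theorem backCycle_insert {B : Finset ℕ} {m c : ℕ} (hm : m ∈ B) (hB : ∀ b ∈ B, b ≤ m) (hc : m < c) :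
    backCycle (insert c B) = swap m c * backCycle B := by
  have hcB : c ∉ B := fun h => (hB c h).not_gt hc
  have hsort_insert : (insert c B).sort (· ≥ ·) = c :: B.sort (· ≥ ·) :=
    Finset.sort_insert _ (fun b hb => (hB b hb).trans hc.le) hcB
  have hsort : B.sort (· ≥ ·) = m :: (B.erase m).sort (· ≥ ·) := by
    conv_lhs => rw [← Finset.insert_erase hm]
    exact Finset.sort_insert _ (fun b hb => hB b (Finset.mem_of_mem_erase hb))
      (Finset.notMem_erase m B)
  rw [backCycle, backCycle, hsort_insert, hsort, List.formPerm_cons_cons, swap_comm]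

theorem leafCycle_cut_false_node (l r : PlaneTree) (a : ℕ) :
    leafCycle ((label (.node () l r) a).cut false).1 =
      swap (a + l.numNodes) (a + l.numLeaves + r.numNodes) *
        leafCycle ((label l a).cut false).1 := by
  have hl := l.numLeaves_eq_numNodes_succ
  have hle : ∀ c ∈ ((label l a).cut false).1.leaves.toFinset, c ≤ a + l.numNodes := fun c hc => by
    have := (exists_mem_pieces_iff false l a c).mp
      ⟨_, List.mem_cons_self, List.mem_toFinset.mp hc⟩
    omega
  rw [leafCycle, leafCycle,
    ← backCycle_insert (List.mem_toFinset.mpr (last_mem_cut_false l a)) hle (by omega)]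
  congr 1
  ext c
  simp [label, LTree.cut, LTree.leaves, cut_true_label]

theorem prod_map_leafCycle_pieces_true (T : PlaneTree) (a : ℕ) :
    ((pieces true T a).map leafCycle).prod =
      (((label T a).cut true).2.map leafCycle).prod := by
  rw [pieces, List.map_cons, List.prod_cons, cut_true_label, leafCycle_leaf, one_mul]

theorem treePerm_eq_prod (b : Bool) (T : PlaneTree) (a : ℕ) :
    treePerm b T a = ((pieces b T a).map leafCycle).prod := by
  induction T generalizing a b with
  | nil => rw [pieces_nil, List.map_singleton, List.prod_singleton, leafCycle_leaf, treePerm]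
  | node _ l r ihl ihr =>
    rw [treePerm, ihl, ihr, prod_map_leafCycle_pieces_true]
    cases b
    · rw [pieces, pieces, List.map_cons, List.map_cons, List.prod_cons, List.prod_cons,
        leafCycle_cut_false_node, label, LTree.cut, List.map_append, List.prod_append, rootSwap,
        if_neg Bool.false_ne_true, mul_assoc, mul_assoc]
    · rw [prod_map_leafCycle_pieces_true, label, LTree.cut, ← List.cons_append, List.map_append,
        List.prod_append, rootSwap, if_pos rfl, one_mul, pieces]

theorem mem_pieces_comb {f : ℕ → PlaneTree} {K a : ℕ} {S : LTree} :
    S ∈ pieces true (comb f K) a ↔ S = .leaf (a + leafCount f K) ∨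
      ∃ k < K, S ∈ pieces false (f k) (a + leafCount f k) := by
  induction K generalizing f a with
  | zero => simp [comb, pieces_nil, leafCount_zero]
  | succ K ih =>
    have hsucc : S ∈ pieces true (comb f (K + 1)) a ↔ S ∈ pieces false (f 0) a ∨
        S ∈ pieces true (comb (fun k => f (k + 1)) K) (a + (f 0).numLeaves) := by
      simp only [pieces, comb, label, LTree.cut, List.mem_cons, List.mem_append]
      tauto
    simp only [hsucc, ih, Nat.exists_lt_succ_left, leafCount_succ', leafCount_zero, add_assoc,
      add_zero]
    tauto

namespace IndexedForest

variable {F : IndexedForest} {K n : ℕ} {S : LTree}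

theorem mem_LC_iff : S ∈ F.LC ↔ ∃ k, S ∈ pieces false (F.tree k) (leafCount F.tree k) := by
  simp only [LC, pieces, Set.mem_ofPred_eq, List.mem_cons]
  rfl

theorem exists_forall_mem_pieces (hS : S ∈ F.LC) :
    ∃ N, ∀ K, N ≤ K → S ∈ pieces true (comb F.tree K) 0 := by
  obtain ⟨k, hk⟩ := mem_LC_iff.mp hS
  exact ⟨k + 1, fun K hK => mem_pieces_comb.mpr (Or.inr ⟨k, hK, by rwa [zero_add]⟩)⟩

theorem TrivialFrom.mem_LC (h : F.TrivialFrom K) (hS : S ∈ pieces true (comb F.tree K) 0) :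
    S ∈ F.LC := by
  rw [mem_LC_iff]
  rcases mem_pieces_comb.mp hS with rfl | ⟨k, -, hk⟩
  · exact ⟨K, by rw [h K le_rfl, pieces_nil, zero_add, List.mem_singleton]⟩
  · exact ⟨k, by rwa [zero_add] at hk⟩

theorem exists_mem_LC (F : IndexedForest) (a : ℕ) : ∃ S ∈ F.LC, a ∈ S.leaves := by
  obtain ⟨M, hM⟩ := F.exists_trivialFrom
  have h := hM.mono (le_max_left M a)
  have ha : a < 0 + (comb F.tree (max M a)).numLeaves := by
    rw [zero_add, BinaryTree.numLeaves_eq_numNodes_succ, numNodes_comb, ← h.size_add]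
    omega
  obtain ⟨S, hS, haS⟩ := (exists_mem_pieces_iff true _ 0 a).mpr ⟨a.zero_le, ha⟩
  exact ⟨S, h.mem_LC hS, haS⟩

theorem pairwise_disjoint_LC (F : IndexedForest) :
    ((fun S : LTree => S.leaves.toFinset) '' F.LC).Pairwise Disjoint := by
  rintro _ ⟨S, hS, rfl⟩ _ ⟨S', hS', rfl⟩ hne
  obtain ⟨N, hN⟩ := exists_forall_mem_pieces hS
  obtain ⟨N', hN'⟩ := exists_forall_mem_pieces hS'
  exact (pairwise_disjoint_pieces true (comb F.tree (max N N')) 0).forall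
    (List.mem_map_of_mem (hN _ (le_max_left _ _)))
    (List.mem_map_of_mem (hN' _ (le_max_right _ _))) hne

theorem perm_apply_of_mem_LC (hS : S ∈ F.LC) {a : ℕ} (ha : a ∈ S.leaves) :
    F.perm a = leafCycle S a := by
  obtain ⟨M, hM⟩ := F.exists_trivialFrom
  obtain ⟨N, hN⟩ := exists_forall_mem_pieces hS
  have hprod : F.perm =
      (((pieces true (comb F.tree (max M N)) 0).map fun S => S.leaves.toFinset).map
        backCycle).prod := by
    rw [← (hM.mono (le_max_left M N)).treePerm_comb, treePerm_eq_prod, List.map_map]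
    rfl
  rw [hprod]
  exact prod_map_backCycle_of_mem (pairwise_disjoint_pieces _ _ _)
    (List.mem_map_of_mem (hN _ (le_max_right M N))) (List.mem_toFinset.mpr ha)

theorem leaves_subset_or_eq_leaf (hF : F ∈ Forest n) (hS : S ∈ F.LC) :
    S.leaves.toFinset ⊆ Finset.range n ∨ ∃ c, n ≤ c ∧ S = .leaf c := by
  obtain ⟨k, hk⟩ := mem_LC_iff.mp hS
  by_cases hnil : F.tree k = .nil
  · rw [hnil, pieces_nil, List.mem_singleton] at hk
    subst hk
    rcases lt_or_ge (leafCount F.tree k) n with hlt | hge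
    · exact Or.inl (by simpa [LTree.leaves] using hlt)
    · exact Or.inr ⟨_, hge, rfl⟩
  · refine Or.inl fun c hc => hF ⟨k, hnil, ?_⟩
    rw [labelled, leaves_label, List.mem_range'_1]
    exact (exists_mem_pieces_iff false _ _ c).mp ⟨S, hk, List.mem_toFinset.mp hc⟩

theorem perm_apply_of_le (hF : F ∈ Forest n) {a : ℕ} (ha : n ≤ a) : F.perm a = a := by
  obtain ⟨S, hS, haS⟩ := F.exists_mem_LC a
  rw [perm_apply_of_mem_LC hS haS]
  rcases leaves_subset_or_eq_leaf hF hS with hsub | ⟨c, -, rfl⟩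
  · exact absurd (Finset.mem_range.mp (hsub (List.mem_toFinset.mpr haS))) ha.not_gt
  · rw [leafCycle_leaf, Perm.one_apply]

theorem forToNC_eq_perm (hF : F ∈ Forest n) : ForToNC n F = F.perm := by
  classical
  ext a
  rw [ForToNC, NCPerm]
  rcases lt_or_ge a n with ha | ha
  · obtain ⟨S, hS, haS⟩ := F.exists_mem_LC a
    have hsub : S.leaves.toFinset ⊆ Finset.range n := by
      rcases leaves_subset_or_eq_leaf hF hS with hsub | ⟨c, hc, rfl⟩
      · exact hsub
      · have := List.mem_singleton.mp haS
        omega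
    rw [perm_apply_of_mem_LC hS haS, leafCycle]
    refine permOfBlocks_apply_of_mem (F.pairwise_disjoint_LC.mono fun B hB => ?_)
      (Finset.mem_filter.mpr ⟨Finset.mem_powerset.mpr hsub, S, hS, rfl⟩)
      (List.mem_toFinset.mpr haS)
    exact (Finset.mem_filter.mp hB).2
  · rw [perm_apply_of_le hF ha]
    refine permOfBlocks_apply_of_notMem fun B hB haB => ?_
    have hsub := Finset.mem_powerset.mp (Finset.mem_filter.mp hB).1
    exact ha.not_gt (Finset.mem_range.mp (hsub haB))

end IndexedForest

end CutTrees

end DoubleForest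

theorem theorem8p13 (n : ℕ) (F : DoubleForest.IndexedForest) (hF : F ∈ DoubleForest.Forest n)
    (σ : Equiv.Perm ℕ) (hσ : σ = DoubleForest.ForToNC n F) :
    σ ∈ DoubleForest.NC n ∧
    DoubleForest.ev σ (DoubleForest.doubleForest F) =
      ∏ p ∈ DoubleForest.invNC n σ,
        (MvPolynomial.X (σ p.1) - MvPolynomial.X (σ p.2) : DoubleForest.PolyT) := by
  have hfixed : ∀ a, n ≤ a → F.perm a = a := fun _ => DoubleForest.IndexedForest.perm_apply_of_le hF
  rw [hσ, DoubleForest.IndexedForest.forToNC_eq_perm hF]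
  exact ⟨DoubleForest.mem_NC_iff.mpr ⟨F.isNC_perm, hfixed⟩,
    DoubleForest.isDoubleForestFamily_doubleForest.ev_perm hfixed⟩
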